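/- For a finite sequence $T=(t_1,\dots,t_m)$ of signs $\pm1$ put $\overline T=(-t_m,\dots,-t_1)$. The empty sequence is the $0$-folding sequence, and the $(n+1)$-folding sequences are the sequences $(\overline T,a,T)$ with $T$ an $n$-folding sequence and $a=\pm1$. An $\infty$-folding sequence is a sequence $(a_k)_{k\ge1}$ of signs such that $(a_1,\dots,a_{2^n-1})$ is an $n$-folding sequence for every $n$; a complete folding sequence is a sequence $(a_k)_{k\in\mathbb Z}$ of signs each of whose finite blocks of consecutive terms is a block of consecutive terms of some $n$-folding sequence. The curve $(C_k)$ associated to a sequence of signs $(a_k)$, with $k$ ranging over $\mathbb N^*$ or over $\mathbb Z$, consists of oriented segments $C_k=[x_k,x_k+\varepsilon_k]$ with $x_k\in\mathbb Z+i\mathbb Z$, $\varepsilon_k\in\{1,-1,i,-i\}$, $x_{k+1}=x_k+\varepsilon_k$ and $\varepsilon_{k+1}=i^{a_k}\varepsilon_k$ (it is rounded at each $x_{k+1}$, so that it does not pass through that point). The starting point and the initial direction are arbitrary. Curves indexed by $\mathbb Z$ are called complete and are considered up to a shift of the index. A covering by complete folding curves is a set of curves associated to complete folding sequences such that each nonoriented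 interval $[z,z+\varepsilon]$ with $z\in\mathbb Z+i\mathbb Z$, $\varepsilon\in\{1,i\}$ is the support of exactly one segment of exactly one of the curves, and such that the orientations are compatible: at the points $x+iy\in\mathbb Z+i\mathbb Z$ with $x+y$ of one parity the horizontal segments start and the vertical segments end, and at the points of the other parity the horizontal segments end and the vertical segments start. A covering by complete folding curves is generated by a curve $C=(C_k)_{k\ge1}$ associated to an $\infty$-folding sequence if, writing $R_j$ for the rotation of angle $j\pi/2$ around the origin $x_1$ of $C$, it contains either the two complete curves "$R_1C$ travelled backwards, then $C$" and "$R_3C$ travelled backwards, then $R_2C$", or the two complete curves "$R_3C$ travelled backwards, then $C$" and "$R_1C$ travelled backwards, then $R_2C$". Two coverings are locally isomorphic if they have, up to translation, the same bounded patterns, a bounded pattern of a covering being a finite set of oriented segments of its curves together with the relation of being consecutive in one of the curves. **Statement.** Let $(a_k)_{k\ge1}$ be the $\infty$-folding sequence with $a_{2^{4n}}=a_{2^{4n+1}}=+1$ and $a_{2^{4n+2}}=a_{2^{4n+3}}=-1$ for each $n\in\mathbb N$, and let $\mathcal C$ be a covering by complete folding curves generated by a curve associated to $(a_k)_{k\ge1}$.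 Then $\mathcal C$ is locally isomorphic to a covering by complete folding curves that consists of exactly $4$ curves. -/

import Mathlib

namespace Paperfolding

/-- The imaginary unit in the ring of Gaussian integers. -/
def I : GaussianInt := ⟨0, 1⟩

/-! ### Folding sequences -/

/-- `(-a_m, …, -a_1)` for a finite sequence `(a_1, …, a_m)` of signs: the sequence of turns of the
same curve travelled backwards. -/
def bar (T : List ℤˣ) : List ℤˣ := (T.map fun a => -a).reverse

/-- `n`-folding sequences, obtained by folding `n` times a strip of paper in two, each time to the
left or to the right, and unfolding it with right angles. The first fold creates the middle crease
`a`; the two halves, which lie on each other, are then folded `n` times together, and they are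
travelled in opposite directions once the strip is unfolded. -/
inductive IsFolding : ℕ → List ℤˣ → Prop
  | zero : IsFolding 0 []
  | succ (n : ℕ) (T : List ℤˣ) (a : ℤˣ) : IsFolding n T → IsFolding (n + 1) (bar T ++ a :: T)

/-- `∞`-folding sequences `(a_k)_{k ≥ 1}`: each `(a_1, …, a_{2^n-1})` is an `n`-folding sequence. -/
def IsInftyFolding (a : ℕ+ → ℤˣ) : Prop :=
  ∀ n : ℕ, IsFolding n (List.ofFn fun k : Fin (2 ^ n - 1) => a (k : ℕ).succPNat)

/-- Complete folding sequences `(a_k)_{k ∈ ℤ}`: each `(a_{k+1}, …, a_{k+l})` is a block of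
consecutive terms of an `n`-folding sequence for some `n`. -/
def IsCompleteFolding (a : ℤ → ℤˣ) : Prop :=
  ∀ (k : ℤ) (l : ℕ), ∃ (n : ℕ) (T : List ℤˣ), IsFolding n T ∧
    (List.ofFn fun j : Fin l => a (k + 1 + (j : ℕ))) <:+: T

/-! ### Segments and curves -/

/-- An oriented segment `[x, x + ε]`, with `x = start` and `ε = dir`. -/
@[ext]
structure Segment where
  start : GaussianInt
  dir : GaussianInt

/-- The segment with the opposite orientation. -/
def Segment.reverse (s : Segment) : Segment := ⟨s.start + s.dir, -s.dir⟩

/-- The image of a segment under the translation by `u`. -/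
def Segment.translate (u : GaussianInt) (s : Segment) : Segment := ⟨s.start + u, s.dir⟩

/-- The curve `(C_k)_{k ≥ 1}` associated to a sequence of signs `turn = (a_k)_{k ≥ 1}`: the segment
`C_k` is `[start k, start k + dir k]`, with `dir k` one of `1, -1, i, -i`, and
`dir (k + 1) = i ^ a_k * dir k` (note that `i ^ a = a * i` for `a = ±1`). -/
@[ext]
structure InftyCurve where
  turn : ℕ+ → ℤˣ
  start : ℕ+ → GaussianInt
  dir : ℕ+ → GaussianInt
  isUnit_dir : ∀ k, IsUnit (dir k)
  start_succ : ∀ k, start (k + 1) = start k + dir k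
  dir_succ : ∀ k, dir (k + 1) = ((turn k : ℤ) : GaussianInt) * I * dir k

/-- The complete curve `(C_k)_{k ∈ ℤ}` associated to a sequence of signs `turn = (a_k)_{k ∈ ℤ}`,
with the same conventions. -/
@[ext]
structure CompleteCurve where
  turn : ℤ → ℤˣ
  start : ℤ → GaussianInt
  dir : ℤ → GaussianInt
  isUnit_dir : ∀ k, IsUnit (dir k)
  start_succ : ∀ k, start (k + 1) = start k + dir k
  dir_succ : ∀ k, dir (k + 1) = ((turn k : ℤ) : GaussianInt) * I * dir k

/-- The `k`-th segment of the curve. -/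
def InftyCurve.seg (H : InftyCurve) (k : ℕ+) : Segment := ⟨H.start k, H.dir k⟩

/-- The `k`-th segment of the curve. -/
def CompleteCurve.seg (γ : CompleteCurve) (k : ℤ) : Segment := ⟨γ.start k, γ.dir k⟩

theorem isUnit_I : IsUnit I :=
  IsUnit.of_mul_eq_one (-I) (by ext <;> simp [I])

/-- The image of `H` under the rotation of angle `j * π / 2` around its origin. -/
def InftyCurve.rotate (H : InftyCurve) (j : ℕ) : InftyCurve where
  turn := H.turn
  start k := H.start 1 + I ^ j * (H.start k - H.start 1)
  dir k := I ^ j * H.dir k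
  isUnit_dir k := (isUnit_I.pow j).mul (H.isUnit_dir k)
  start_succ k := by rw [H.start_succ]; ring
  dir_succ k := by rw [H.dir_succ]; ring

/-- `γ` is obtained by connecting `K` and `H` at their common origin: it consists of the curve `K`
travelled backwards, followed by the curve `H`. -/
def CompleteCurve.Connects (γ : CompleteCurve) (K H : InftyCurve) : Prop :=
  ∃ m : ℤ, ∀ k : ℕ+, γ.seg (m + ((k : ℕ) : ℤ)) = H.seg k ∧
    γ.seg (m + 1 - ((k : ℕ) : ℤ)) = (K.seg k).reverse

/-! ### Coverings

A set of complete curves is given by one parametrization of each of its members. In a covering, two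
parametrizations of the same curve cannot both occur, because each interval is the support of only
one segment. -/

/-- The oriented segments of the curves of `𝒞`. -/
def segments (𝒞 : Set CompleteCurve) : Set Segment :=
  {s | ∃ γ ∈ 𝒞, ∃ k : ℤ, γ.seg k = s}

/-- The segments `s`, `t` are consecutive, in this order, in a curve of `𝒞`. -/
def Consecutive (𝒞 : Set CompleteCurve) (s t : Segment) : Prop :=
  ∃ γ ∈ 𝒞, ∃ k : ℤ, γ.seg k = s ∧ γ.seg (k + 1) = t

/-- `𝒞` covers the plane: each nonoriented interval `[z, z + ε]` with `ε ∈ {1, i}` is the support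
of exactly one segment of one curve of `𝒞`. -/
def Covers (𝒞 : Set CompleteCurve) : Prop :=
  ∀ z ε : GaussianInt, (ε = 1 ∨ ε = I) →
    ∃! p : CompleteCurve × ℤ, p.1 ∈ 𝒞 ∧
      (p.1.seg p.2 = ⟨z, ε⟩ ∨ p.1.seg p.2 = Segment.reverse ⟨z, ε⟩)

/-- The orientations of the curves of `𝒞` are compatible: at all points `x + i y` where `x + y` has
one parity, horizontal segments start and vertical segments end; at all other points, horizontal
segments end and vertical segments start. (Each segment joins two points of different parities, so
that it is enough to consider its initial point.) -/
def Coherent (𝒞 : Set CompleteCurve) : Prop :=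
  ∃ q : ℤ, ∀ s ∈ segments 𝒞, s.dir.im = 0 ↔ Even (s.start.re + s.start.im + q)

/-- Coverings of the plane by complete folding curves. -/
structure IsFoldingCovering (𝒞 : Set CompleteCurve) : Prop where
  covers : Covers 𝒞
  coherent : Coherent 𝒞
  folding : ∀ γ ∈ 𝒞, IsCompleteFolding γ.turn

/-- `𝒞` is a covering generated by `H`: it contains the two complete curves obtained by connecting,
in one of the two possible ways, the four images of `H` under the rotations of angles
`0, π / 2, π, 3 π / 2` around its origin. -/
def IsGeneratedBy (𝒞 : Set CompleteCurve) (H : InftyCurve) : Prop :=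
  IsFoldingCovering 𝒞 ∧ ∃ γ ∈ 𝒞, ∃ δ ∈ 𝒞,
    (γ.Connects (H.rotate 1) (H.rotate 0) ∧ δ.Connects (H.rotate 3) (H.rotate 2)) ∨
    (γ.Connects (H.rotate 3) (H.rotate 0) ∧ δ.Connects (H.rotate 1) (H.rotate 2))

/-- Each bounded pattern of `𝒞` (finitely many segments of curves of `𝒞`, together with the
connections between them) appears in `𝒟` up to a translation. -/
def PatternsAppearIn (𝒞 𝒟 : Set CompleteCurve) : Prop :=
  ∀ F : Set Segment, F.Finite → F ⊆ segments 𝒞 →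
    ∃ u : GaussianInt, (∀ s ∈ F, s.translate u ∈ segments 𝒟) ∧
      ∀ s ∈ F, ∀ t ∈ F, Consecutive 𝒞 s t ↔ Consecutive 𝒟 (s.translate u) (t.translate u)

/-- `𝒞` and `𝒟` are locally isomorphic: they have the same bounded patterns up to translation. -/
def LocallyIsomorphic (𝒞 𝒟 : Set CompleteCurve) : Prop :=
  PatternsAppearIn 𝒞 𝒟 ∧ PatternsAppearIn 𝒟 𝒞

end Paperfolding

namespace Paperfolding

/-! The generated covering is encoded by the sign of its turn at each vertex. Placing the origin of
the generating curve at 0, this sign is the function `toeplitz ω period`: at (1 + i)^n W with W odd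
it depends on n modulo 4 and on the parity of the real part of W, and at 0 it is ω, which records
the way the four copies of the curve are connected.

Two properties carry the proof. Self-similarity: the curves for τ are obtained from those for `shift
τ` by multiplying by 1 + i and replacing each edge by two edges at a right angle (`flow_flow_sub`).
Invariance under multiplication by 3 (`toeplitz_three_mul`): on the sublattice 3ℤ[i], with edges of
length 3, the same signs describe a copy of the generated covering. The second covering is read on
the coset 3ℤ[i] + i, which avoids 0.

To count curves, each edge is sent to its `parent` in the coarser lattice. This contracts the plane
up to a bounded error, so that after multiples of 8 steps every edge reaches a finite set of fixed
edges: the four edges at the origin for length 1, and `fourEdges` on the coset for length 3.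
Distances along a curve are roughly halved by `parent`, so fixed edges on the same curve are equal
or consecutive (`not_sameCycle`). The edges of `fourEdges` are never consecutive, whence exactly
four curves. Common ancestors also show that finite blocks of turns are blocks of folding sequences
(`isFolding_block`).

For the local isomorphism, signs away from 0 are unchanged by translations by multiples of a high
power 16^m, and 16^m ≡ 1 modulo 3 makes it possible to pass from one coset to the other
(`exists_translation_to`, `exists_translation_from`). -/

/-! ### Folding sequences by interleaving -/

/-- The sequence `(x, t₁, -x, t₂, x, …)`. -/
def zig : ℤˣ → List ℤˣ → List ℤˣ
  | x, [] => [x]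
  | x, a :: T => x :: a :: zig (-x) T

theorem zig_append (x a : ℤˣ) (A B : List ℤˣ) :
    zig x (A ++ a :: B) = zig x A ++ a :: zig ((-1) ^ (A.length + 1) * x) B := by
  induction A generalizing x with
  | nil => simp [zig]
  | cons b A ih => simp [zig, ih, pow_succ]

theorem length_bar (T : List ℤˣ) : (bar T).length = T.length := by
  simp [bar]

/-- The last alternating term is (-1)^|T| x. Reversal puts it first, and `bar` adds one more sign.
-/
theorem bar_zig (x : ℤˣ) (T : List ℤˣ) :
    bar (zig x T) = zig ((-1) ^ (T.length + 1) * x) (bar T) := by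
  induction T generalizing x with
  | nil => simp [zig, bar]
  | cons a T ih =>
    have h1 : bar (zig x (a :: T)) = bar (zig (-x) T) ++ [-a, -x] := by
      simp [zig, bar]
    have h2 : bar (a :: T) = bar T ++ [-a] := by simp [bar]
    rw [h1, h2, ih, zig_append, length_bar]
    have h3 : ((-1 : ℤˣ) ^ T.length) * (-1) ^ T.length = 1 := by
      rw [← mul_pow]; simp
    simp [zig, pow_succ, ← mul_assoc, h3]

/-- Adding a finest fold to a strip commutes with joining the two halves at the first fold, because
`bar` and `zig` commute up to the initial sign. This turns the definition by the first fold into a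
recursion by the last one. -/
theorem IsFolding.zig {n : ℕ} {T : List ℤˣ} (h : IsFolding n T) (x : ℤˣ) :
    IsFolding (n + 1) (zig x T) := by
  induction h generalizing x with
  | zero => exact IsFolding.succ 0 [] x IsFolding.zero
  | succ n T a _ ih =>
    have := IsFolding.succ _ _ a (ih ((-1) ^ (T.length + 1) * x))
    rw [bar_zig, ← mul_assoc, ← mul_pow] at this
    rw [zig_append, length_bar]
    simpa using this

theorem IsFolding.exists_zig {n : ℕ} {L : List ℤˣ} (h : IsFolding (n + 1) L) :
    ∃ x T, IsFolding n T ∧ L = Paperfolding.zig x T := by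
  induction n generalizing L with
  | zero =>
    cases h with
    | succ _ T a hT => cases hT; exact ⟨a, [], IsFolding.zero, rfl⟩
  | succ n ih =>
    cases h with
    | succ _ T a hT =>
      obtain ⟨y, T', hT', rfl⟩ := ih hT
      refine ⟨(-1) ^ (T'.length + 1) * y, bar T' ++ a :: T', IsFolding.succ _ _ _ hT', ?_⟩
      rw [bar_zig, zig_append, length_bar, ← mul_assoc, ← mul_pow]
      simp

theorem length_zig (x : ℤˣ) (T : List ℤˣ) : (zig x T).length = 2 * T.length + 1 := by
  induction T generalizing x with
  | nil => rfl
  | cons a T ih => simp [zig, ih]; ring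

theorem zig_getElem?_even (x : ℤˣ) (T : List ℤˣ) (k : ℕ) (hk : k ≤ T.length) :
    (zig x T)[2 * k]? = some ((-1) ^ k * x) := by
  induction k generalizing x T with
  | zero => cases T <;> simp [zig]
  | succ k ih =>
    cases T with
    | nil => simp at hk
    | cons a T =>
      have := ih (-x) T (by simpa using hk)
      simp only [zig, mul_add, mul_one, List.getElem?_cons_succ, this]
      simp [pow_succ]

theorem zig_getElem?_odd (x : ℤˣ) (T : List ℤˣ) (k : ℕ) :
    (zig x T)[2 * k + 1]? = T[k]? := by
  induction k generalizing x T with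
  | zero => cases T <;> simp [zig]
  | succ k ih =>
    cases T with
    | nil => simp [zig]
    | cons a T =>
      simpa only [zig, mul_add, mul_one, List.getElem?_cons_succ] using ih (-x) T

theorem ofFn_eq_zig (f g : ℕ → ℤˣ) (m : ℕ) (hf : ∀ k, f (2 * k) = (-1) ^ k * f 0)
    (hg : ∀ k, f (2 * k + 1) = g k) :
    (List.ofFn fun k : Fin (2 * m + 1) => f k) = zig (f 0) (List.ofFn fun k : Fin m => g k) := by
  refine List.ext_getElem? fun i => ?_
  rcases Nat.even_or_odd' i with ⟨k, rfl | rfl⟩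
  · by_cases hk : k ≤ m
    · rw [zig_getElem?_even _ _ _ (by simpa using hk), List.getElem?_ofFn, dif_pos (by omega), hf]
    · rw [List.getElem?_eq_none (by simp; omega),
        List.getElem?_eq_none (by simp [length_zig]; omega)]
  · rw [zig_getElem?_odd, List.getElem?_ofFn, List.getElem?_ofFn]
    by_cases hk : k < m
    · rw [dif_pos (by omega), dif_pos hk, hg]
    · rw [dif_neg (by omega), dif_neg hk]

/-- Each `(f 0, …, f (2 ^ n - 2))` is an `n`-folding sequence. -/
def Folds (f : ℕ → ℤˣ) : Prop :=
  ∀ n : ℕ, IsFolding n (List.ofFn fun k : Fin (2 ^ n - 1) => f k)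

theorem Folds.exists_zig {f : ℕ → ℤˣ} (h : Folds f) (n : ℕ) :
    ∃ x T, IsFolding n T ∧ T.length = 2 ^ n - 1 ∧
      (∀ k < 2 ^ n, f (2 * k) = (-1) ^ k * x) ∧ ∀ k < 2 ^ n - 1, T[k]? = some (f (2 * k + 1)) := by
  obtain ⟨x, T, hT, hL⟩ := (h (n + 1)).exists_zig
  have hl := congrArg List.length hL
  have hp : 0 < 2 ^ n := by positivity
  rw [length_zig, List.length_ofFn, pow_succ] at hl
  refine ⟨x, T, hT, by omega, fun k hk => ?_, fun k hk => ?_⟩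
  · have := zig_getElem?_even x T k (by omega)
    rw [← hL, List.getElem?_ofFn, dif_pos (by rw [pow_succ]; omega)] at this
    simpa using this
  · rw [← zig_getElem?_odd x, ← hL, List.getElem?_ofFn, dif_pos (by rw [pow_succ]; omega)]

/-- Indices start at 0, so these are the terms of odd rank of the folding sequence. Those of even
rank form a folding sequence again by `Folds.odd`. -/
theorem Folds.even {f : ℕ → ℤˣ} (h : Folds f) (k : ℕ) : f (2 * k) = (-1) ^ k * f 0 := by
  obtain ⟨x, T, -, -, h1, -⟩ := h.exists_zig k
  have := h1 0 (by positivity)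
  rw [h1 k Nat.lt_two_pow_self]
  simp at this
  rw [this]

theorem Folds.odd {f : ℕ → ℤˣ} (h : Folds f) : Folds fun k => f (2 * k + 1) := by
  intro n
  obtain ⟨x, T, hT, hl, -, h2⟩ := h.exists_zig n
  convert hT using 1
  refine List.ext_getElem? fun i => ?_
  rw [List.getElem?_ofFn]
  by_cases hi : i < 2 ^ n - 1
  · rw [dif_pos hi, h2 i hi]
  · rw [dif_neg hi, List.getElem?_eq_none (by omega)]

section

/-! ### Gaussian integers -/

/-- The sum of the coordinates, whose parity is the class modulo `1 + i`. -/
def coordSum (Z : GaussianInt) : ℤ := Z.re + Z.im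

@[simp] theorem I_re : I.re = 0 := rfl
@[simp] theorem I_im : I.im = 1 := rfl

theorem coordSum_add (Z W : GaussianInt) : coordSum (Z + W) = coordSum Z + coordSum W := by
  simp [coordSum]; ring

theorem coordSum_intCast_mul (l : ℤ) (Z : GaussianInt) : coordSum (l * Z) = l * coordSum Z := by
  simp [coordSum]; ring

theorem even_coordSum_mul (Z : GaussianInt) : Even (coordSum ((1 + I) * Z)) :=
  ⟨Z.re, by simp [coordSum]⟩

theorem I_mul_I : I * I = -1 := by ext <;> simp

/-- The quotient of `Z` by `1 + i`, for `Z` divisible by it. -/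
def half (Z : GaussianInt) : GaussianInt := ⟨(Z.re + Z.im) / 2, (Z.im - Z.re) / 2⟩

theorem half_mul (Z : GaussianInt) : half ((1 + I) * Z) = Z := by
  ext <;> simp [half] <;> omega

theorem mul_half {Z : GaussianInt} (h : Even (coordSum Z)) : (1 + I) * half Z = Z := by
  obtain ⟨a, ha⟩ := h
  simp only [coordSum] at ha
  ext <;> simp [half] <;> omega

theorem natAbs_norm_half_lt {Z : GaussianInt} (h : ¬ Z = 0) (h2 : ¬ Odd (coordSum Z)) :
    (half Z).norm.natAbs < Z.norm.natAbs := by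
  rw [Int.not_odd_iff_even] at h2
  have h1 := congrArg Zsqrtd.norm (mul_half h2)
  rw [Zsqrtd.norm_mul, show (1 + I).norm = 2 from rfl] at h1
  have h3 : 0 < Z.norm := GaussianInt.norm_pos.2 h
  omega

theorem isUnit_cases {d : GaussianInt} (h : IsUnit d) : d = 1 ∨ d = -1 ∨ d = I ∨ d = -I := by
  have h1 : d.norm = 1 := (Zsqrtd.norm_eq_one_iff' (by norm_num) d).2 h
  rw [Zsqrtd.norm_def] at h1
  have h2 : d.re ^ 2 ≤ 1 := by nlinarith [sq_nonneg d.im]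
  have h3 : d.im ^ 2 ≤ 1 := by nlinarith [sq_nonneg d.re]
  obtain ⟨h4, h5⟩ := abs_le.1 ((sq_le_one_iff_abs_le_one _).1 h2)
  obtain ⟨h6, h7⟩ := abs_le.1 ((sq_le_one_iff_abs_le_one _).1 h3)
  obtain ⟨x, y⟩ := d
  simp only at h1 h4 h5 h6 h7
  interval_cases x <;> interval_cases y <;> simp_all [Zsqrtd.ext_iff]

theorem odd_coordSum {d : GaussianInt} (h : IsUnit d) : Odd (coordSum d) := by
  rcases isUnit_cases h with rfl | rfl | rfl | rfl <;> simp [coordSum]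

theorem isUnit_intUnit (a : ℤˣ) : IsUnit ((a : ℤ) : GaussianInt) :=
  a.isUnit.map (Int.castRingHom GaussianInt)

theorem intUnit_mul_self (a : ℤˣ) : ((a : ℤ) : GaussianInt) * ((a : ℤ) : GaussianInt) = 1 := by
  rw [← Int.cast_mul, ← Units.val_mul, Int.units_mul_self]; simp

theorem im_turn {d : GaussianInt} (h : IsUnit d) (a : ℤˣ) :
    (((a : ℤ) : GaussianInt) * I * d).im = 0 ↔ ¬ d.im = 0 := by
  rcases Int.units_eq_one_or a with rfl | rfl <;>
    rcases isUnit_cases h with rfl | rfl | rfl | rfl <;> simp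

theorem im_I_mul {d : GaussianInt} (h : IsUnit d) : (I * d).im = 0 ↔ ¬ d.im = 0 := by
  simpa using im_turn h 1

theorem im_neg_I_mul {d : GaussianInt} (h : IsUnit d) : (-I * d).im = 0 ↔ ¬ d.im = 0 := by
  simpa using im_turn h (-1)

theorem isUnit_turn {d : GaussianInt} (h : IsUnit d) (a : ℤˣ) :
    IsUnit (((a : ℤ) : GaussianInt) * I * d) :=
  ((isUnit_intUnit a).mul isUnit_I).mul h

/-- Induction on the exponent of `1 + i`. -/
theorem gaussianInt_induction {P : GaussianInt → Prop} (zero : P 0)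
    (odd : ∀ Z, Odd (coordSum Z) → P Z) (mul : ∀ Z, ¬ Z = 0 → P Z → P ((1 + I) * Z))
    (Z : GaussianInt) : P Z := by
  induction h : Z.norm.natAbs using Nat.strong_induction_on generalizing Z with
  | _ n ih =>
    by_cases h0 : Z = 0
    · exact h0 ▸ zero
    by_cases h1 : Odd (coordSum Z)
    · exact odd Z h1
    · have h2 := mul_half (Int.not_odd_iff_even.1 h1)
      rw [← h2]
      refine mul _ (fun h3 => h0 ?_) (ih _ (h ▸ natAbs_norm_half_lt h0 h1) _ rfl)
      rw [← h2, h3, mul_zero]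

/-! ### Signs of the vertices -/

/-- The sequence without its first term. -/
def shift (τ : ℕ → ℤ) : ℕ → ℤ := fun n => τ (n + 1)

/-- A Toeplitz function on the Gaussian integers: at `(1 + i) ^ n * W` with `W` odd, it depends only
on the parities of `τ (n + 1)` and of the real part of `W`. Its value at `0` is `ω`. -/
def toeplitz (ω : ℤˣ) (τ : ℕ → ℤ) (Z : GaussianInt) : ℤˣ :=
  if _h0 : Z = 0 then ω
  else if _h1 : Odd (coordSum Z) then Int.negOnePow (τ 1 + Z.re + 1)
  else toeplitz ω (shift τ) (half Z)
  termination_by Z.norm.natAbs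
  decreasing_by exact natAbs_norm_half_lt _h0 _h1

variable (ω : ℤˣ) (τ : ℕ → ℤ) (l : ℤ)

theorem toeplitz_zero : toeplitz ω τ 0 = ω := by
  rw [toeplitz]; simp

theorem toeplitz_odd {Z : GaussianInt} (h : Odd (coordSum Z)) :
    toeplitz ω τ Z = Int.negOnePow (τ 1 + Z.re + 1) := by
  rw [toeplitz, dif_neg, dif_pos h]
  rintro rfl
  simp [coordSum] at h

theorem one_add_I_ne_zero : (1 + I) ≠ 0 := by simp [Zsqrtd.ext_iff]

theorem toeplitz_mul (Z : GaussianInt) :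
    toeplitz ω τ ((1 + I) * Z) = toeplitz ω (shift τ) Z := by
  by_cases h : Z = 0
  · simp [h, toeplitz_zero]
  · rw [toeplitz, dif_neg (mul_ne_zero one_add_I_ne_zero h),
      dif_neg (Int.not_odd_iff_even.2 (even_coordSum_mul Z)), half_mul]

/-- An odd rational integer changes neither the exponent of 1 + i nor the parity of the real part of
the odd cofactor. -/
theorem toeplitz_three_mul (Z : GaussianInt) :
    toeplitz ω τ (3 * Z) = toeplitz ω τ Z := by
  induction Z using gaussianInt_induction generalizing τ with
  | zero => simp
  | odd Z h =>
    have h3 : (3 : GaussianInt) * Z = ((3 : ℤ) : GaussianInt) * Z := by norm_num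
    rw [toeplitz_odd _ _ h, toeplitz_odd, Int.negOnePow_eq_iff]
    · rw [h3]; simp; exact ⟨Z.re, by ring⟩
    · rw [h3, coordSum_intCast_mul]; exact Odd.mul (by decide) h
  | mul Z _ ih => rw [mul_left_comm, toeplitz_mul, toeplitz_mul, ih]

/-- Exactly one coordinate of an odd W is odd, and multiplication by i exchanges the parities of the
coordinates. -/
theorem toeplitz_I_mul {Z : GaussianInt} (hZ : Z ≠ 0) :
    toeplitz ω τ (I * Z) = -toeplitz ω τ Z := by
  induction Z using gaussianInt_induction generalizing τ with
  | zero => simp at hZ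
  | odd Z h =>
    rw [toeplitz_odd _ _ h, toeplitz_odd, ← Int.negOnePow_succ, Int.negOnePow_eq_iff]
    · obtain ⟨k, hk⟩ := h
      simp only [coordSum] at hk
      have : (I * Z).re = -Z.im := by simp
      exact ⟨-k - 1, by omega⟩
    · obtain ⟨k, hk⟩ := h
      simp only [coordSum] at hk
      exact ⟨k - Z.im, by simp [coordSum]; omega⟩
  | mul Z h ih => rw [mul_left_comm, toeplitz_mul, toeplitz_mul, ih _ h]

/-- The sign at (1 + i)^n W depends only on W modulo 2, and 2 is associated to (1 + i)^2. This
almost periodicity away from 0 is the source of the local isomorphisms. -/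
theorem exists_toeplitz_add {Z : GaussianInt} (hZ : Z ≠ 0) :
    ∃ n, ∀ m ≥ n, ∀ K, toeplitz ω τ (Z + (1 + I) ^ m * K) = toeplitz ω τ Z := by
  induction Z using gaussianInt_induction generalizing τ with
  | zero => simp at hZ
  | odd Z h =>
    refine ⟨2, fun m hm K => ?_⟩
    obtain ⟨m, rfl⟩ := Nat.exists_eq_add_of_le hm
    have h2 : (1 + I) ^ (2 + m) * K = ((2 : ℤ) : GaussianInt) * (I * ((1 + I) ^ m * K)) := by
      have : (1 + I) ^ 2 = 2 * I := by ext <;> simp [pow_two]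
      rw [pow_add, this]; push_cast; ring
    rw [h2, toeplitz_odd _ _ h, toeplitz_odd, Int.negOnePow_eq_iff]
    · exact ⟨(I * ((1 + I) ^ m * K)).re, by rw [Zsqrtd.re_add, Zsqrtd.re_smul]; ring⟩
    · rw [coordSum_add, coordSum_intCast_mul]
      exact h.add_even (even_two_mul _)
  | mul Z h ih =>
    obtain ⟨n, hn⟩ := ih (shift τ) h
    refine ⟨n + 1, fun m hm K => ?_⟩
    obtain ⟨m, rfl⟩ := Nat.exists_eq_add_of_le' hm
    rw [← add_assoc, pow_succ', mul_assoc, ← mul_add, toeplitz_mul, toeplitz_mul,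
      hn _ (by omega)]

/-! ### The flow along the curves -/

/-- The successor of a segment in the curves which turn by `σ` at the vertices of a lattice
with edges of length `l`. -/
def flow (σ : GaussianInt → ℤˣ) (l : ℤ) : Equiv.Perm Segment where
  toFun s := ⟨s.start + l * s.dir, ((σ (s.start + l * s.dir) : ℤ) : GaussianInt) * I * s.dir⟩
  -- If s.dir = σ i d, then d = -σ i s.dir, since (σ i)² = -1.
  invFun s := ⟨s.start - l * (((-σ s.start : ℤˣ) : ℤ) * I * s.dir),
    (((-σ s.start : ℤˣ) : ℤ) : GaussianInt) * I * s.dir⟩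
  left_inv s := by
    have h := intUnit_mul_self (σ (s.start + l * s.dir))
    have h1 : (((-σ (s.start + l * s.dir) : ℤˣ) : ℤ) : GaussianInt) * I *
        (((σ (s.start + l * s.dir) : ℤ) : GaussianInt) * I * s.dir) = s.dir := by
      push_cast
      linear_combination (-s.dir * ((σ (s.start + l * s.dir) : ℤ) : GaussianInt) ^ 2) * I_mul_I +
        s.dir * h
    ext1
    · simp only [h1]; ring
    · exact h1
  right_inv s := by
    have h := intUnit_mul_self (σ s.start)
    ext1
    · simp
    · simp only [sub_add_cancel]
      push_cast
      linear_combination (-s.dir * ((σ s.start : ℤ) : GaussianInt) ^ 2) * I_mul_I + s.dir * h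

/-- Segments with the right orientation. -/
def Valid (q : ℤ) (s : Segment) : Prop :=
  IsUnit s.dir ∧ (s.dir.im = 0 ↔ Even (coordSum s.start + q))

variable {l} in
-- An edge of odd length changes the parity of the vertex, while the turn exchanges horizontal and
-- vertical.
theorem Valid.flow {q : ℤ} {s : Segment} (h : Valid q s) (hl : Odd l) (σ : GaussianInt → ℤˣ) :
    Valid q (flow σ l s) := by
  refine ⟨isUnit_turn h.1 _, ?_⟩
  have h1 : Odd (l * coordSum s.dir) := hl.mul (odd_coordSum h.1)
  simp only [Paperfolding.flow, Equiv.coe_fn_mk]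
  rw [im_turn h.1, h.2, coordSum_add, coordSum_intCast_mul, Int.not_even_iff_odd]
  have : coordSum s.start + l * coordSum s.dir + q =
    (coordSum s.start + q) + l * coordSum s.dir := by ring
  rw [this, Int.even_add]
  rw [← Int.not_even_iff_odd] at h1 ⊢
  tauto

variable {l} in
theorem Valid.flow_symm {q : ℤ} {s : Segment} (h : Valid q s) (hl : Odd l)
    (σ : GaussianInt → ℤˣ) : Valid q ((Paperfolding.flow σ l).symm s) := by
  have h0 : IsUnit ((Paperfolding.flow σ l).symm s).dir := isUnit_turn h.1 (-σ s.start)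
  refine ⟨h0, ?_⟩
  have h1 : Odd (l * coordSum ((Paperfolding.flow σ l).symm s).dir) := hl.mul (odd_coordSum h0)
  have h2 : ((Paperfolding.flow σ l).symm s).dir.im = 0 ↔ ¬ s.dir.im = 0 :=
    im_turn h.1 (-σ s.start)
  have h3 : coordSum ((Paperfolding.flow σ l).symm s).start =
      coordSum s.start - l * coordSum ((Paperfolding.flow σ l).symm s).dir := by
    rw [eq_sub_iff_add_eq, ← coordSum_intCast_mul, ← coordSum_add]
    simp [Paperfolding.flow]
  rw [h2, h.2, h3]
  have : ∀ a b : ℤ, Odd b → (¬ Even (a + q) ↔ Even (a - b + q)) := by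
    intro a b hb
    rw [show a - b + q = a + q - b by ring, Int.even_sub]
    rw [← Int.not_even_iff_odd] at hb
    tauto
  exact this _ _ h1

variable {l} in
theorem Valid.zpow {q : ℤ} {s : Segment} (h : Valid q s) (hl : Odd l) (σ : GaussianInt → ℤˣ)
    (k : ℤ) : Valid q ((Paperfolding.flow σ l ^ k) s) := by
  induction k using Int.induction_on with
  | zero => simpa
  | succ k ih =>
    rw [add_comm, zpow_add, zpow_one]
    exact ih.flow hl σ
  | pred k ih =>
    rw [sub_eq_add_neg, add_comm, zpow_add, zpow_neg_one]
    exact ih.flow_symm hl σ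

variable {l} in
theorem Valid.pow {q : ℤ} {s : Segment} (h : Valid q s) (hl : Odd l) (σ : GaussianInt → ℤˣ)
    (k : ℕ) : Valid q ((Paperfolding.flow σ l ^ k) s) :=
  h.zpow hl σ (k : ℤ)

/-! ### Subdivision of the segments and its inverse -/

/-- The first of the two segments which replace `p` when the lattice is refined. -/
def sub (p : Segment) : Segment :=
  -- Since (1 + i) d = d + i d, the two new edges are d and i d in one of the two orders. The
  -- initial vertex is now even, so τ 0 decides whether the horizontal one comes first.
  ⟨(1 + I) * p.start, if (p.dir.im = 0 ↔ Even (τ 0)) then p.dir else I * p.dir⟩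

/-- The inverse of `sub`. -/
def up (s : Segment) : Segment :=
  ⟨half s.start,
    if (s.dir.im = 0 ↔ Even (coordSum (half s.start) + τ 1)) then s.dir else -I * s.dir⟩

variable {τ}

theorem valid_sub {p : Segment} (h : Valid (τ 1) p) : Valid (τ 0) (sub τ p) := by
  have h1 : Even (coordSum ((1 + I) * p.start) + τ 0) ↔ Even (τ 0) := by
    simp [Int.even_add, even_coordSum_mul]
  unfold sub Valid
  simp only [h1]
  split_ifs with h2
  · exact ⟨h.1, h2⟩
  · exact ⟨isUnit_I.mul h.1, by rw [im_I_mul h.1]; tauto⟩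

theorem valid_up {s : Segment} (h : IsUnit s.dir) : Valid (τ 1) (up τ s) := by
  unfold up Valid
  split_ifs with h2
  · exact ⟨h, h2⟩
  · exact ⟨isUnit_I.neg.mul h, by simp only [im_neg_I_mul h]; tauto⟩

theorem neg_I_mul_I_mul (d : GaussianInt) : -I * (I * d) = d := by
  linear_combination (-d) * I_mul_I

theorem I_mul_neg_I_mul (d : GaussianInt) : I * (-I * d) = d := by
  linear_combination (-d) * I_mul_I

theorem up_sub {p : Segment} (h : Valid (τ 1) p) : up τ (sub τ p) = p := by
  unfold up sub
  ext1
  · exact half_mul _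
  · simp only [half_mul]
    have h1 := h.2
    have h2 := im_I_mul h.1
    by_cases h3 : (p.dir.im = 0 ↔ Even (τ 0))
    · simp only [h3, if_true]; rw [if_pos]; tauto
    · rw [if_neg h3, if_neg, neg_I_mul_I_mul]; tauto

theorem sub_up {s : Segment} (h : Valid (τ 0) s) (h0 : Even (coordSum s.start)) :
    sub τ (up τ s) = s := by
  have h1 : Even (coordSum s.start + τ 0) ↔ Even (τ 0) := by simp [Int.even_add, h0]
  have h2 := h.2
  have h3 := im_neg_I_mul h.1
  unfold up sub
  ext1
  · exact mul_half h0
  · simp only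
    by_cases h4 : (s.dir.im = 0 ↔ Even (coordSum (half s.start) + τ 1))
    · simp only [h4, if_true]; rw [if_pos]; tauto
    · rw [if_neg h4, if_neg, I_mul_neg_I_mul]; tauto

variable {l}

theorem odd_mid (hl : Odd l) {d : GaussianInt} (hd : IsUnit d) (Z : GaussianInt) :
    Odd (coordSum ((1 + I) * Z + l * d)) := by
  rw [coordSum_add, coordSum_intCast_mul]
  exact (even_coordSum_mul Z).add_odd (hl.mul (odd_coordSum hd))

/-- The sign of the vertex in the middle of the two segments which replace `p`. -/
theorem toeplitz_mid (hl : Odd l) {p : Segment} (h : Valid (τ 1) p) :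
    toeplitz ω τ ((sub τ p).start + l * (sub τ p).dir) =
      if (p.dir.im = 0 ↔ Even (τ 0)) then 1 else -1 := by
  have hv := valid_sub h
  have hodd : Odd (coordSum ((sub τ p).start + l * (sub τ p).dir)) := odd_mid hl hv.1 _
  rw [toeplitz_odd _ _ hodd]
  have h1 : (sub τ p).dir.im = 0 ↔ Even (τ 0) := by
    rw [hv.2]; simp [sub, Int.even_add, even_coordSum_mul]
  have h2 : Even (sub τ p).dir.re ↔ ¬ (sub τ p).dir.im = 0 := by
    rcases isUnit_cases hv.1 with h | h | h | h <;> simp [h]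
  have h3 := h.2
  have h4 : Even (τ 1 + ((sub τ p).start + l * (sub τ p).dir).re + 1) ↔
      (Even (coordSum p.start + τ 1) ↔ Even (τ 0)) := by
    rw [← h1, ← not_iff_not (a := Even (coordSum p.start + τ 1)),
      show ((sub τ p).dir.im = 0) = ¬¬((sub τ p).dir.im = 0) by rw [not_not], ← h2]
    have : ((sub τ p).start + l * (sub τ p).dir).re =
        p.start.re - p.start.im + l * (sub τ p).dir.re := by
      have h5 : (sub τ p).start.re = p.start.re - p.start.im := by simp [sub]; ring
      rw [Zsqrtd.re_add, Zsqrtd.re_smul, h5]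
    rw [this]
    have hl' := Int.not_even_iff_odd.2 hl
    simp only [coordSum, Int.even_add, Int.even_sub, Int.even_mul, Int.not_even_one]
    tauto
  split_ifs with h5
  · exact Int.negOnePow_even _ (by rw [h4]; tauto)
  · exact Int.negOnePow_odd _ (by rw [← Int.not_even_iff_odd, h4]; tauto)

theorem flow_sub_dir (hl : Odd l) {p : Segment} (h : Valid (τ 1) p) :
    (flow (toeplitz ω τ) l (sub τ p)).dir =
      if (p.dir.im = 0 ↔ Even (τ 0)) then I * p.dir else p.dir := by
  have : (flow (toeplitz ω τ) l (sub τ p)).dir =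
    ((toeplitz ω τ ((sub τ p).start + l * (sub τ p).dir) : ℤ) : GaussianInt) * I *
      (sub τ p).dir := rfl
  rw [this, toeplitz_mid ω hl h, sub]
  split_ifs
  · simp
  · simpa using neg_I_mul_I_mul p.dir

/-- The two edges replacing p end at 1 + i times the end of p, where the sign for τ is the sign for
`shift τ` at the end of p. Horizontal and vertical alternate from p to its successor, so the order
of the two directions is exchanged and the turn is the right one. -/
theorem flow_flow_sub (hl : Odd l) {p : Segment} (h : Valid (τ 1) p) :
    flow (toeplitz ω τ) l (flow (toeplitz ω τ) l (sub τ p)) =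
      sub τ (flow (toeplitz ω (shift τ)) l p) := by
  have h1 := flow_sub_dir ω hl h
  have h2 : (flow (toeplitz ω τ) l (flow (toeplitz ω τ) l (sub τ p))).start =
      (1 + I) * (p.start + l * p.dir) := by
    have : (flow (toeplitz ω τ) l (flow (toeplitz ω τ) l (sub τ p))).start =
      (sub τ p).start + l * (sub τ p).dir + l * (flow (toeplitz ω τ) l (sub τ p)).dir := rfl
    rw [this, h1, sub]
    split_ifs <;> simp only <;> ring
  ext1
  · exact h2
  · have : (flow (toeplitz ω τ) l (flow (toeplitz ω τ) l (sub τ p))).dir =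
      ((toeplitz ω τ (flow (toeplitz ω τ) l (flow (toeplitz ω τ) l (sub τ p))).start : ℤ) :
        GaussianInt) * I * (flow (toeplitz ω τ) l (sub τ p)).dir := rfl
    rw [this, h2, toeplitz_mul, h1]
    have h3 := im_turn h.1 (toeplitz ω (shift τ) (p.start + l * p.dir))
    simp only [sub, flow, Equiv.coe_fn_mk, h3]
    split_ifs <;> first | ring1 | (exfalso; tauto)

/-- The segment of the coarser lattice whose subdivision contains `s`. -/
def parent (τ : ℕ → ℤ) (l : ℤ) (s : Segment) : Segment :=
  if Even (coordSum s.start) then up τ s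
  else
    -- This is the direction of the preceding edge, with the sign at an odd vertex written out. In
    -- this form it does not involve ω, and ancestors of explicit edges can be evaluated by `rfl`.
    let d := if Even (τ 1 + s.start.re) then I * s.dir else -I * s.dir
    up τ ⟨s.start - l * d, d⟩

theorem parent_odd {s : Segment} (h : ¬ Even (coordSum s.start)) :
    parent τ l s = up τ ((flow (toeplitz ω τ) l).symm s) := by
  have : (flow (toeplitz ω τ) l).symm s =
    ⟨s.start - l * (((-toeplitz ω τ s.start : ℤˣ) : ℤ) * I * s.dir),
    (((-toeplitz ω τ s.start : ℤˣ) : ℤ) : GaussianInt) * I * s.dir⟩ := rfl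
  rw [this, parent, if_neg h, toeplitz_odd _ _ (Int.not_even_iff_odd.1 h), Int.negOnePow_succ,
    neg_neg]
  split_ifs with h1
  · simp [Int.negOnePow_even _ h1]
  · simp [Int.negOnePow_odd _ (Int.not_even_iff_odd.1 h1)]

theorem parent_sub {p : Segment} (h : Valid (τ 1) p) : parent τ l (sub τ p) = p := by
  have h0 : Even (coordSum (sub τ p).start) := even_coordSum_mul _
  rw [parent, if_pos h0, up_sub h]

theorem parent_flow_sub (hl : Odd l) {p : Segment} (h : Valid (τ 1) p) :
    parent τ l (flow (toeplitz ω τ) l (sub τ p)) = p := by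
  rw [parent_odd ω, Equiv.symm_apply_apply, up_sub h]
  exact Int.not_even_iff_odd.2 (odd_mid hl (valid_sub h).1 _)

theorem valid_parent {s : Segment} (h : Valid (τ 0) s) (hl : Odd l) :
    Valid (τ 1) (parent τ l s) := by
  by_cases h0 : Even (coordSum s.start)
  · rw [parent, if_pos h0]
    exact valid_up h.1
  · rw [parent_odd 1 h0]
    exact valid_up (h.flow_symm hl _).1

theorem eq_sub_parent {s : Segment} (h : Valid (τ 0) s) (hl : Odd l) :
    s = sub τ (parent τ l s) ∨ s = flow (toeplitz ω τ) l (sub τ (parent τ l s)) := by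
  by_cases h0 : Even (coordSum s.start)
  · rw [parent, if_pos h0, sub_up h h0]
    exact Or.inl rfl
  · right
    have h1 := h.flow_symm hl (toeplitz ω τ)
    rw [parent_odd ω h0, sub_up h1, Equiv.apply_symm_apply]
    have h2 := odd_coordSum h1.1
    have h3 : coordSum s.start = coordSum ((flow (toeplitz ω τ) l).symm s).start +
        l * coordSum ((flow (toeplitz ω τ) l).symm s).dir := by
      rw [← coordSum_intCast_mul, ← coordSum_add]
      conv_lhs => rw [← Equiv.apply_symm_apply (flow (toeplitz ω τ) l) s]
      rfl
    have h4 := hl.mul h2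
    rw [h3] at h0
    by_contra h5
    exact h0 ((Int.not_even_iff_odd.1 h5).add_odd h4)

end

section

variable (ω : ℤˣ) {τ : ℕ → ℤ} {l : ℤ}

/-! ### Iterated subdivision -/

theorem pow_two_mul_sub (hl : Odd l) {p : Segment} (h : Valid (τ 1) p) (k : ℕ) :
    (flow (toeplitz ω τ) l ^ (2 * k)) (sub τ p) =
      sub τ ((flow (toeplitz ω (shift τ)) l ^ k) p) := by
  induction k with
  | zero => rfl
  | succ k ih =>
    rw [show 2 * (k + 1) = 1 + (1 + 2 * k) by ring, pow_add, pow_add, pow_one, Equiv.Perm.mul_apply,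
      Equiv.Perm.mul_apply, ih, flow_flow_sub ω hl (h.pow hl _ k), pow_succ',
      Equiv.Perm.mul_apply]

theorem turn_sub_even (hl : Odd l) {p : Segment} (h : Valid (τ 1) p) (k : ℕ) :
    toeplitz ω τ ((flow (toeplitz ω τ) l ^ (2 * k)) (sub τ p)).start =
      toeplitz ω (shift τ) ((flow (toeplitz ω (shift τ)) l ^ k) p).start := by
  rw [pow_two_mul_sub ω hl h]
  exact toeplitz_mul _ _ _

theorem im_dir_pow (σ : GaussianInt → ℤˣ) {p : Segment} (h : IsUnit p.dir) (k : ℕ) :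
    IsUnit ((flow σ l ^ k) p).dir ∧
      (((flow σ l ^ k) p).dir.im = 0 ↔ (p.dir.im = 0 ↔ Even k)) := by
  induction k with
  | zero => simpa
  | succ k ih =>
    rw [pow_succ', Equiv.Perm.mul_apply]
    refine ⟨isUnit_turn ih.1 _, ?_⟩
    have := im_turn ih.1 (σ (((flow σ l ^ k) p).start + l * ((flow σ l ^ k) p).dir))
    rw [Nat.even_add_one]
    simp only [flow, Equiv.coe_fn_mk] at *
    tauto

/-- The turn inside the subdivision of an edge depends only on whether this edge is horizontal,
which alternates along the coarse curve. -/
theorem turn_sub_odd (hl : Odd l) {p : Segment} (h : Valid (τ 1) p) (k : ℕ) :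
    toeplitz ω τ ((flow (toeplitz ω τ) l ^ (2 * k + 1)) (sub τ p)).start =
      (-1) ^ k * toeplitz ω τ ((flow (toeplitz ω τ) l ^ 1) (sub τ p)).start := by
  have key : ∀ p, Valid (τ 1) p → toeplitz ω τ (flow (toeplitz ω τ) l (sub τ p)).start =
      if (p.dir.im = 0 ↔ Even (τ 0)) then 1 else -1 := fun p hp => toeplitz_mid ω hl hp
  rw [add_comm, pow_add, pow_one, Equiv.Perm.mul_apply, pow_two_mul_sub ω hl h,
    key _ (h.pow hl _ k), key _ h]
  have h1 := (im_dir_pow (l := l) (toeplitz ω (shift τ)) h.1 k).2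
  simp only [h1]
  rcases Nat.even_or_odd k with h2 | h2
  · simp [h2]
  · have := Nat.not_even_iff_odd.2 h2
    simp only [this, h2.neg_one_pow, iff_false]
    split_ifs <;> first | rfl | (exfalso; tauto)

/-- The first of the `2 ^ n` segments which replace `p` after `n` subdivisions. -/
def subIter (τ : ℕ → ℤ) : ℕ → Segment → Segment
  | 0, p => p
  | n + 1, p => sub τ (subIter (shift τ) n p)

/-- The ancestor of `s` after `n` steps. -/
def parentIter (τ : ℕ → ℤ) (l : ℤ) : ℕ → Segment → Segment
  | 0, s => s
  | n + 1, s => parentIter (shift τ) l n (parent τ l s)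

theorem valid_subIter {n : ℕ} {p : Segment} (h : Valid ((shift^[n] τ) 0) p) :
    Valid (τ 0) (subIter τ n p) := by
  induction n generalizing τ with
  | zero => exact h
  | succ n ih => exact valid_sub (ih (τ := shift τ) h)

theorem valid_parentIter (hl : Odd l) (n : ℕ) {s : Segment} (h : Valid (τ 0) s) :
    Valid ((shift^[n] τ) 0) (parentIter τ l n s) := by
  induction n generalizing τ s with
  | zero => exact h
  | succ n ih => exact ih (τ := shift τ) (valid_parent h hl)

/-- Each subdivision interleaves an alternating sequence with the previous turns, which is the
recursion `IsFolding.zig`. -/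
theorem isFolding_subIter (hl : Odd l) (n : ℕ) {p : Segment} (h : Valid ((shift^[n] τ) 0) p) :
    IsFolding n (List.ofFn fun k : Fin (2 ^ n - 1) =>
      toeplitz ω τ ((flow (toeplitz ω τ) l ^ ((k : ℕ) + 1)) (subIter τ n p)).start) := by
  induction n generalizing τ with
  | zero => exact IsFolding.zero
  | succ n ih =>
    have hv : Valid (shift τ 0) (subIter (shift τ) n p) := valid_subIter h
    have h1 : 2 ^ (n + 1) - 1 = 2 * (2 ^ n - 1) + 1 := by
      have : 0 < 2 ^ n := by positivity
      rw [pow_succ]; omega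
    have h2 := ofFn_eq_zig (fun k => toeplitz ω τ
        ((flow (toeplitz ω τ) l ^ (k + 1)) (subIter τ (n + 1) p)).start)
      (fun k => toeplitz ω (shift τ)
        ((flow (toeplitz ω (shift τ)) l ^ (k + 1)) (subIter (shift τ) n p)).start) (2 ^ n - 1)
      (fun k => turn_sub_odd ω hl hv k) (fun k => turn_sub_even ω hl hv (k + 1))
    rw [← h1] at h2
    rw [h2]
    exact (ih (τ := shift τ) h).zig _

theorem exists_pow_subIter (hl : Odd l) (n : ℕ) {s : Segment} (h : Valid (τ 0) s) :
    ∃ a < 2 ^ n, (flow (toeplitz ω τ) l ^ a) (subIter τ n (parentIter τ l n s)) = s := by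
  induction n generalizing τ s with
  | zero => exact ⟨0, by simp, rfl⟩
  | succ n ih =>
    have hv := valid_parent h hl
    obtain ⟨a, ha, h1⟩ := ih (τ := shift τ) hv
    have hv' : Valid (τ 1) (subIter (shift τ) n (parentIter (shift τ) l n (parent τ l s))) :=
      valid_subIter (τ := shift τ) (valid_parentIter (τ := shift τ) hl n hv)
    have h2 := pow_two_mul_sub ω hl hv' a
    rw [h1] at h2
    rcases eq_sub_parent ω h hl with h3 | h3
    · exact ⟨2 * a, by rw [pow_succ]; omega, h2.trans h3.symm⟩
    · refine ⟨1 + 2 * a, by rw [pow_succ]; omega, ?_⟩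
      rw [pow_add, pow_one, Equiv.Perm.mul_apply]
      exact (congrArg _ h2).trans h3.symm

theorem sameCycle_of_parentIter_eq (hl : Odd l) (n : ℕ) {s t : Segment} (hs : Valid (τ 0) s)
    (ht : Valid (τ 0) t) (h : parentIter τ l n s = parentIter τ l n t) :
    (flow (toeplitz ω τ) l).SameCycle s t := by
  obtain ⟨a, -, ha⟩ := exists_pow_subIter ω hl n hs
  obtain ⟨b, -, hb⟩ := exists_pow_subIter ω hl n ht
  rw [h] at ha
  exact Equiv.Perm.SameCycle.trans (Equiv.Perm.SameCycle.symm ⟨a, ha⟩) ⟨b, hb⟩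

/-! ### Distances along the curves -/

/-- As s is the first or the second half of its parent, m steps from s pass ⌊m / 2⌋ or ⌊(m + 1) / 2⌋
steps between parents. -/
theorem parent_pow (hl : Odd l) {s : Segment} (h : Valid (τ 0) s) (m : ℕ) :
    ∃ m', (flow (toeplitz ω (shift τ)) l ^ m') (parent τ l s) =
      parent τ l ((flow (toeplitz ω τ) l ^ m) s) ∧ 2 * m' ≤ m + 1 ∧ m ≤ 2 * m' + 1 := by
  have hv := valid_parent h hl
  have key : ∀ a, parent τ l ((flow (toeplitz ω τ) l ^ a) (sub τ (parent τ l s))) =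
      (flow (toeplitz ω (shift τ)) l ^ (a / 2)) (parent τ l s) := by
    intro a
    have hv' := hv.pow hl (toeplitz ω (shift τ)) (a / 2)
    rcases Nat.even_or_odd' a with ⟨b, rfl | rfl⟩
    · rw [pow_two_mul_sub ω hl hv]
      rw [Nat.mul_div_cancel_left _ two_pos] at hv' ⊢
      exact parent_sub hv'
    · rw [show (2 * b + 1) / 2 = b by omega] at hv' ⊢
      rw [add_comm, pow_add, pow_one, Equiv.Perm.mul_apply, pow_two_mul_sub ω hl hv]
      exact parent_flow_sub ω hl hv'
  rcases eq_sub_parent ω h hl with h3 | h3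
  · refine ⟨m / 2, ?_, by omega, by omega⟩
    rw [← key, ← h3]
  · refine ⟨(m + 1) / 2, ?_, by omega, by omega⟩
    rw [← key, pow_succ, Equiv.Perm.mul_apply, ← h3]

theorem flow_ne_self (hl : Odd l) (σ : GaussianInt → ℤˣ) {s : Segment} (h : IsUnit s.dir) :
    flow σ l s ≠ s := by
  intro h1
  have h2 : s.start + l * s.dir = s.start := congrArg Segment.start h1
  have h3 : (l : GaussianInt) * s.dir = 0 := by simpa using h2
  rcases mul_eq_zero.1 h3 with h4 | h4
  · rw [Int.cast_eq_zero.1 h4] at hl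
    exact absurd hl (by decide)
  · exact h.ne_zero h4

/-- A closed curve of length m > 1 would have a shorter closed curve of parents. The descent ends at
length 1, impossible because an edge and its successor have different initial points. -/
theorem pow_ne_self (hl : Odd l) {s : Segment} (h : Valid (τ 0) s) {m : ℕ} (hm : 0 < m) :
    (flow (toeplitz ω τ) l ^ m) s ≠ s := by
  induction m using Nat.strong_induction_on generalizing τ s with
  | _ m ih =>
    intro h1
    rcases Nat.lt_or_ge 1 m with h2 | h2
    · obtain ⟨m', h3, h4, h5⟩ := parent_pow ω hl h m
      rw [h1] at h3
      exact ih m' (by omega) (τ := shift τ) (valid_parent h hl) (by omega) h3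
    · obtain rfl : m = 1 := by omega
      exact flow_ne_self hl _ h.1 h1

theorem zpow_injective (hl : Odd l) {s : Segment} (h : Valid (τ 0) s) :
    Function.Injective fun k : ℤ => (flow (toeplitz ω τ) l ^ k) s := by
  have key : ∀ (j : ℤ) (m : ℕ), 0 < m →
      (flow (toeplitz ω τ) l ^ (j + m)) s ≠ (flow (toeplitz ω τ) l ^ j) s := by
    intro j m hm h1
    rw [add_comm, zpow_add, Equiv.Perm.mul_apply] at h1
    exact pow_ne_self ω hl (h.zpow hl _ j) hm h1
  intro j k h1
  rcases lt_trichotomy j k with h2 | h2 | h2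
  · obtain ⟨m, rfl⟩ := Int.le.dest h2.le
    exact absurd h1.symm (key j m (by omega))
  · exact h2
  · obtain ⟨m, rfl⟩ := Int.le.dest h2.le
    exact absurd h1 (key k m (by omega))

theorem parentIter_pow (hl : Odd l) (n : ℕ) {s : Segment} (h : Valid (τ 0) s) (m : ℕ) :
    ∃ m' ≤ m, (flow (toeplitz ω (shift^[n] τ)) l ^ m') (parentIter τ l n s) =
      parentIter τ l n ((flow (toeplitz ω τ) l ^ m) s) ∧ (2 ≤ m → 0 < n → m' < m) := by
  induction n generalizing τ s m with
  | zero => exact ⟨m, le_rfl, rfl, by simp⟩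
  | succ n ih =>
    obtain ⟨m₁, h1, h2, h3⟩ := parent_pow ω hl h m
    obtain ⟨m₂, h4, h5, -⟩ := ih (τ := shift τ) (valid_parent h hl) m₁
    rw [h1] at h5
    exact ⟨m₂, by omega, h5, by omega⟩

/-- Two fixed edges at distance m ≥ 2 are their own ancestors, hence are also joined by strictly
fewer steps. -/
theorem eq_or_flow_eq_of_pow (hl : Odd l) {n : ℕ} (hn : 0 < n) (hτ : shift^[n] τ = τ)
    {s t : Segment} (hv : Valid (τ 0) s) (hs : parentIter τ l n s = s)
    (ht : parentIter τ l n t = t) {m : ℕ} (h : (flow (toeplitz ω τ) l ^ m) s = t) :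
    s = t ∨ flow (toeplitz ω τ) l s = t := by
  induction m using Nat.strong_induction_on with
  | _ m ih =>
    rcases Nat.lt_or_ge 1 m with h2 | h2
    · obtain ⟨m', h3, h4, h5⟩ := parentIter_pow ω hl n hv m
      rw [hτ, hs, h, ht] at h4
      exact ih m' (by omega) h4
    · interval_cases m
      · exact Or.inl h
      · exact Or.inr h

/-- Segments which are their own ancestors belong to distinct curves unless they are consecutive. -/
theorem not_sameCycle (hl : Odd l) {n : ℕ} (hn : 0 < n) (hτ : shift^[n] τ = τ)
    {s t : Segment} (hvs : Valid (τ 0) s) (hvt : Valid (τ 0) t) (hs : parentIter τ l n s = s)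
    (ht : parentIter τ l n t = t) (h0 : s ≠ t) (h1 : flow (toeplitz ω τ) l s ≠ t)
    (h2 : flow (toeplitz ω τ) l t ≠ s) : ¬ (flow (toeplitz ω τ) l).SameCycle s t := by
  rintro ⟨k, hk⟩
  rcases Int.eq_nat_or_neg k with ⟨m, rfl | rfl⟩
  · rcases eq_or_flow_eq_of_pow ω hl hn hτ hvs hs ht (m := m) hk with h | h
    exacts [h0 h, h1 h]
  · rw [zpow_neg, Equiv.Perm.inv_eq_iff_eq] at hk
    rcases eq_or_flow_eq_of_pow ω hl hn hτ hvt ht hs (m := m) hk.symm with h | h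
    exacts [h0 h.symm, h2 h]

/-! ### Ancestors of all segments -/

/-- Twice the middle of a segment. -/
def mid (l : ℤ) (s : Segment) : GaussianInt := 2 * s.start + l * s.dir

/-- The middle of the scaled parent is the middle of the chord of the two-edge path. It differs from
the middle of either edge by half of the other one. -/
theorem exists_mul_mid_parent (hl : Odd l) {s : Segment} (h : Valid (τ 0) s) :
    ∃ d, IsUnit d ∧ (1 + I) * mid l (parent τ l s) = mid l s + l * d := by
  have hv := valid_parent h hl
  have h1 := flow_sub_dir 1 hl hv
  have h2 : (flow (toeplitz 1 τ) l (sub τ (parent τ l s))).start =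
    (sub τ (parent τ l s)).start + l * (sub τ (parent τ l s)).dir := rfl
  have h4 : (sub τ (parent τ l s)).start = (1 + I) * (parent τ l s).start := rfl
  have h5 : (sub τ (parent τ l s)).dir = if ((parent τ l s).dir.im = 0 ↔ Even (τ 0)) then
    (parent τ l s).dir else I * (parent τ l s).dir := rfl
  rcases eq_sub_parent 1 h hl with h3 | h3
  · generalize parent τ l s = p at *
    subst h3
    refine ⟨(flow (toeplitz 1 τ) l (sub τ p)).dir, isUnit_turn h.1 _, ?_⟩
    simp only [mid, h1, h4, h5]
    split_ifs <;> ring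
  · have hu := (valid_sub hv).1
    generalize parent τ l s = p at *
    subst h3
    refine ⟨-(sub τ p).dir, hu.neg, ?_⟩
    simp only [mid, h1, h2, h4, h5]
    split_ifs <;> ring

theorem norm_mid_parent (hl : Odd l) {s : Segment} (h : Valid (τ 0) s) :
    ∃ a : ℤ, a ^ 2 ≤ (mid l s).norm ∧
      2 * (mid l (parent τ l s)).norm = (mid l s).norm + l ^ 2 + 2 * l * a := by
  obtain ⟨d, hd, h1⟩ := exists_mul_mid_parent hl h
  have h2 := congrArg Zsqrtd.norm h1
  rw [Zsqrtd.norm_mul, show (1 + I).norm = 2 from rfl] at h2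
  rw [h2]
  have h3 : (mid l s).norm = (mid l s).re ^ 2 + (mid l s).im ^ 2 := by
    rw [Zsqrtd.norm_def]; ring
  have h4 := sq_nonneg (mid l s).re
  have h5 := sq_nonneg (mid l s).im
  rcases isUnit_cases hd with rfl | rfl | rfl | rfl
  · exact ⟨(mid l s).re, by linarith, by rw [h3, Zsqrtd.norm_def]; simp; ring⟩
  · exact ⟨-(mid l s).re, by linarith [neg_sq (mid l s).re],
      by rw [h3, Zsqrtd.norm_def]; simp; ring⟩
  · exact ⟨(mid l s).im, by linarith, by rw [h3, Zsqrtd.norm_def]; simp; ring⟩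
  · exact ⟨-(mid l s).im, by linarith [neg_sq (mid l s).im],
      by rw [h3, Zsqrtd.norm_def]; simp; ring⟩

/-- By `norm_mid_parent`, `h1` makes the ball of squared radius B stable (a bound by 2B + 1 on the
doubled norm is enough, norms being integers), and `h2` makes the norm strictly decrease outside it.
-/
theorem norm_mid_parentIter {B : ℤ} (hl : Odd l)
    (h1 : ∀ N a : ℤ, a ^ 2 ≤ N → N ≤ B → N + l ^ 2 + 2 * l * a ≤ 2 * B + 1)
    (h2 : ∀ N a : ℤ, a ^ 2 ≤ N → B < N → l ^ 2 + 2 * l * a < N) (n : ℕ) {s : Segment}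
    (h : Valid (τ 0) s) :
    (mid l (parentIter τ l n s)).norm ≤ B ∨
      (mid l (parentIter τ l n s)).norm + n ≤ (mid l s).norm := by
  induction n generalizing τ s with
  | zero => right; simp [parentIter]
  | succ n ih =>
    obtain ⟨a, h3, h4⟩ := norm_mid_parent hl h
    rcases ih (τ := shift τ) (valid_parent h hl) with h5 | h5
    · exact Or.inl h5
    by_cases h6 : (mid l s).norm ≤ B
    · have := h1 _ _ h3 h6
      left
      change (mid l (parentIter (shift τ) l n (parent τ l s))).norm ≤ B
      omega
    · have := h2 _ _ h3 (not_le.1 h6)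
      right
      change (mid l (parentIter (shift τ) l n (parent τ l s))).norm + _ ≤ _
      push_cast
      omega

theorem exists_iterate_parentIter_mem {B : ℤ} (hl : Odd l)
    (h1 : ∀ N a : ℤ, a ^ 2 ≤ N → N ≤ B → N + l ^ 2 + 2 * l * a ≤ 2 * B + 1)
    (h2 : ∀ N a : ℤ, a ^ 2 ≤ N → B < N → l ^ 2 + 2 * l * a < N) {n : ℕ} (hn : 0 < n)
    {P : Segment → Prop} (hP : ∀ s, P s → Valid (τ 0) s)
    (hP' : ∀ s, P s → P (parentIter τ l n s)) {A : Set Segment}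
    (hA : ∀ s, P s → (mid l s).norm ≤ B → parentIter τ l n s ∈ A) {s : Segment} (hs : P s) :
    ∃ k, (parentIter τ l n)^[k] s ∈ A := by
  induction h : (mid l s).norm.natAbs using Nat.strong_induction_on generalizing s with
  | _ N ih =>
    by_cases h3 : (mid l s).norm ≤ B
    · exact ⟨1, hA s hs h3⟩
    have h0 := GaussianInt.norm_nonneg (mid l (parentIter τ l n s))
    obtain ⟨k, hk⟩ : ∃ k, (parentIter τ l n)^[k] (parentIter τ l n s) ∈ A := by
      rcases norm_mid_parentIter hl h1 h2 n (hP s hs) with h4 | h4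
      · exact ⟨1, hA _ (hP' s hs) h4⟩
      · exact ih _ (by omega) (hP' s hs) rfl
    exact ⟨k + 1, hk⟩

theorem parentIter_add (n m : ℕ) (s : Segment) :
    parentIter τ l (n + m) s = parentIter (shift^[n] τ) l m (parentIter τ l n s) := by
  induction n generalizing τ s with
  | zero => simp [parentIter]
  | succ n ih =>
    rw [Nat.add_right_comm]
    exact ih (τ := shift τ) (parent τ l s)

theorem iterate_shift {n : ℕ} (hτ : shift^[n] τ = τ) (k : ℕ) : shift^[n * k] τ = τ := by
  rw [Function.iterate_mul]
  exact Function.iterate_fixed hτ k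

theorem iterate_parentIter {n : ℕ} (hτ : shift^[n] τ = τ) (k : ℕ) (s : Segment) :
    (parentIter τ l n)^[k] s = parentIter τ l (n * k) s := by
  induction k generalizing s with
  | zero => rfl
  | succ k ih =>
    rw [Function.iterate_succ_apply, ih, Nat.mul_succ, Nat.add_comm, parentIter_add,
      hτ]

theorem sameCycle_of_iterate {n : ℕ} (hl : Odd l) (hτ : shift^[n] τ = τ) {s e : Segment}
    (hs : Valid (τ 0) s) (hv : Valid (τ 0) e) (he : parentIter τ l n e = e) {k : ℕ}
    (h : (parentIter τ l n)^[k] s = e) : (flow (toeplitz ω τ) l).SameCycle e s := by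
  refine sameCycle_of_parentIter_eq ω hl (n * k) hv hs ?_
  rw [← iterate_parentIter hτ, ← iterate_parentIter hτ, h]
  exact Function.iterate_fixed he k

theorem ofFn_infix {α : Type*} (f : ℕ → α) {a m M : ℕ} (h : m + a ≤ M) :
    (List.ofFn fun j : Fin m => f (j + a)) <:+: List.ofFn fun k : Fin M => f k := by
  have h1 : (List.ofFn fun j : Fin m => f (j + a)) =
      ((List.ofFn fun k : Fin M => f k).drop a).take m := by
    refine List.ext_getElem (by simp; omega) fun i h1 h2 => ?_
    simp [add_comm]
  rw [h1]
  exact (List.take_prefix _ _).isInfix.trans (List.drop_suffix _ _).isInfix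

/-- The turns along the curves are complete folding sequences. -/
theorem isFolding_block {n : ℕ} (hl : Odd l) (hτ : shift^[n] τ = τ) {A : Set Segment}
    (hAv : ∀ e ∈ A, Valid (τ 0) e) (hA : ∀ e ∈ A, parentIter τ l n e = e)
    (hA' : ∀ e ∈ A, ∀ f ∈ A, (flow (toeplitz ω τ) l).SameCycle e f → e = f) {s : Segment}
    (hs : Valid (τ 0) s)
    (h : ∀ m : ℕ, ∃ k, (parentIter τ l n)^[k] ((flow (toeplitz ω τ) l ^ m) s) ∈ A) (m : ℕ) :
    ∃ (N : ℕ) (T : List ℤˣ), IsFolding N T ∧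
      (List.ofFn fun j : Fin m =>
        toeplitz ω τ ((flow (toeplitz ω τ) l ^ ((j : ℕ) + 1)) s).start) <:+: T := by
  obtain ⟨k₀, h0⟩ := h 0
  obtain ⟨k₁, h1⟩ := h m
  have hv := hs.pow hl (toeplitz ω τ) m
  have e0 := sameCycle_of_iterate ω hl hτ hs (hAv _ h0) (hA _ h0) rfl
  have e1 := sameCycle_of_iterate ω hl hτ hv (hAv _ h1) (hA _ h1) rfl
  -- The two ends of the block have fixed ancestors on the same curve, so these ancestors coincide.
  -- After k₁ + k₀ rounds both ends have reached this common ancestor.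
  have heq := hA' _ h0 _ h1 ((e0.trans ⟨m, rfl⟩).trans e1.symm)
  have f0 : parentIter τ l (n * (k₁ + k₀)) s = (parentIter τ l n)^[k₀] s := by
    rw [← iterate_parentIter hτ, Function.iterate_add_apply]
    exact Function.iterate_fixed (hA _ h0) k₁
  have f1 : parentIter τ l (n * (k₁ + k₀)) ((flow (toeplitz ω τ) l ^ m) s) =
      (parentIter τ l n)^[k₀] s := by
    rw [← iterate_parentIter hτ, add_comm, Function.iterate_add_apply, ← heq]
    exact Function.iterate_fixed (hA _ h0) k₀
  obtain ⟨a, ha, ha'⟩ := exists_pow_subIter ω hl (n * (k₁ + k₀)) hs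
  obtain ⟨b, hb, hb'⟩ := exists_pow_subIter ω hl (n * (k₁ + k₀)) hv
  rw [f0] at ha'
  rw [f1] at hb'
  have hve : Valid ((shift^[n * (k₁ + k₀)] τ) 0) ((parentIter τ l n)^[k₀] s) := by
    rw [iterate_shift hτ]; exact hAv _ h0
  generalize (parentIter τ l n)^[k₀] s = e at *
  generalize n * (k₁ + k₀) = N at *
  -- The ends occupy positions a and b < 2 ^ N among the descendants of e, and a curve never repeats
  -- an edge. Hence the block lies within the 2 ^ N - 1 interior turns.
  have hab : m + a = b := by
    have := zpow_injective ω hl (valid_subIter hve) (a₁ := ((m + a : ℕ) : ℤ)) (a₂ := (b : ℤ))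
      (by simp only [zpow_natCast]; rw [pow_add, Equiv.Perm.mul_apply, ha', hb'])
    exact_mod_cast this
  refine ⟨N, _, isFolding_subIter ω hl N hve, ?_⟩
  have := ofFn_infix (fun k => toeplitz ω τ
    ((flow (toeplitz ω τ) l ^ (k + 1)) (subIter τ N e)).start) (a := a) (m := m)
    (M := 2 ^ N - 1) (by omega)
  convert this using 5 with j
  rw [← ha', ← Equiv.Perm.mul_apply, ← pow_add]
  congr 2
  ring

end

/-! ### The two families of curves -/

/-- The parities which correspond to the signs `+1, +1, -1, -1` of period `4`. -/
def period (n : ℕ) : ℤ := if n % 4 = 3 then 1 else 0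

/-- The signs already have period 4, but (1 + i)^4 = -4 ≡ -1 modulo 3 would exchange the cosets of i
and -i. With 8 steps the factor is 16 ≡ 1, and the coset is preserved. -/
theorem shift_period : shift^[8] period = period := by
  funext n
  simp only [Function.iterate_succ, Function.iterate_zero, Function.comp_apply, id, shift, period]
  rw [show (n + 1 + 1 + 1 + 1 + 1 + 1 + 1 + 1) % 4 = n % 4 by omega]

theorem abs_le_of_sq_le {x N : ℤ} {b : ℕ} (h : x ^ 2 ≤ N) (hN : N < (b + 1) ^ 2) :
    -(b : ℤ) ≤ x ∧ x ≤ b := by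
  have h1 : x ^ 2 < ((b : ℤ) + 1) ^ 2 := by linarith
  have := abs_lt_of_sq_lt_sq' h1 (by positivity)
  omega

/-- The segments with an endpoint at the origin. -/
def starEdges : Set Segment := {⟨0, 1⟩, ⟨0, -1⟩, ⟨I, -I⟩, ⟨-I, I⟩}

/-- Representatives of the four curves of the second covering. -/
def fourEdges : Fin 4 → Segment :=
  ![⟨⟨0, -2⟩, 1⟩, ⟨⟨3, 1⟩, -1⟩, ⟨⟨0, 1⟩, -I⟩, ⟨⟨-3, -2⟩, I⟩]

theorem valid_fourEdges (j : Fin 4) : Valid (period 0) (fourEdges j) := by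
  fin_cases j <;> simp [fourEdges, Valid, period, coordSum, isUnit_I, isUnit_I.neg] <;> decide

theorem parentIter_fourEdges (j : Fin 4) :
    parentIter period 3 8 (fourEdges j) = fourEdges j := by
  fin_cases j <;> rfl

theorem parentIter_mem_starEdges {s : Segment} (h : Valid (period 0) s)
    (hs : (mid 1 s).norm ≤ 5) : parentIter period 1 8 s ∈ starEdges := by
  obtain ⟨⟨x, y⟩, d⟩ := s
  obtain ⟨h1, h2⟩ := h
  simp only at h1 h2
  obtain ⟨⟨hx, hx'⟩, hy, hy'⟩ : (-1 ≤ x ∧ x ≤ 1) ∧ -1 ≤ y ∧ y ≤ 1 := by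
    have h3 : (2 * x + d.re) ^ 2 + (2 * y + d.im) ^ 2 ≤ 5 := by
      refine le_of_eq_of_le ?_ hs
      rw [Zsqrtd.norm_def]; simp [mid]; ring
    have h4 := abs_le_of_sq_le (b := 2) (x := 2 * x + d.re)
      (by nlinarith [sq_nonneg (2 * y + d.im)]) (by norm_num : (5 : ℤ) < _)
    have h5 := abs_le_of_sq_le (b := 2) (x := 2 * y + d.im)
      (by nlinarith [sq_nonneg (2 * x + d.re)]) (by norm_num : (5 : ℤ) < _)
    rcases isUnit_cases h1 with rfl | rfl | rfl | rfl <;> simp at h4 h5 <;> omega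
  -- Finite check: a candidate either has the wrong orientation or has an ancestor found by
  -- evaluation.
  rcases isUnit_cases h1 with rfl | rfl | rfl | rfl <;> interval_cases x <;> interval_cases y <;>
    first
    | exact absurd h2 (by decide)
    | exact Or.inl rfl
    | exact Or.inr (Or.inl rfl)
    | exact Or.inr (Or.inr (Or.inl rfl))
    | exact Or.inr (Or.inr (Or.inr rfl))

theorem parentIter_mem_range_fourEdges {s : Segment} (h : Valid (period 0) s)
    (h0 : ∃ W, s.start = 3 * W + I) (hs : (mid 3 s).norm ≤ 52) :
    parentIter period 3 8 s ∈ Set.range fourEdges := by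
  obtain ⟨_, d⟩ := s
  obtain ⟨⟨x, y⟩, rfl⟩ := h0
  obtain ⟨h1, h2⟩ := h
  simp only at h1 h2
  obtain ⟨⟨hx, hx'⟩, hy, hy'⟩ : (-1 ≤ x ∧ x ≤ 1) ∧ -2 ≤ y ∧ y ≤ 1 := by
    have h3 : (6 * x + 3 * d.re) ^ 2 + (6 * y + 2 + 3 * d.im) ^ 2 ≤ 52 := by
      refine le_of_eq_of_le ?_ hs
      rw [Zsqrtd.norm_def]; simp [mid]; ring
    have h4 := abs_le_of_sq_le (b := 7) (x := 6 * x + 3 * d.re)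
      (by nlinarith [sq_nonneg (6 * y + 2 + 3 * d.im)]) (by norm_num : (52 : ℤ) < _)
    have h5 := abs_le_of_sq_le (b := 7) (x := 6 * y + 2 + 3 * d.im)
      (by nlinarith [sq_nonneg (6 * x + 3 * d.re)]) (by norm_num : (52 : ℤ) < _)
    rcases isUnit_cases h1 with rfl | rfl | rfl | rfl <;> simp at h4 h5 <;> omega
  rcases isUnit_cases h1 with rfl | rfl | rfl | rfl <;> interval_cases x <;> interval_cases y <;>
    first
    | exact absurd h2 (by decide)
    | exact ⟨0, rfl⟩
    | exact ⟨1, rfl⟩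
    | exact ⟨2, rfl⟩
    | exact ⟨3, rfl⟩

/-! ### Every edge lies on the curve of a fixed edge -/

section

variable (ω : ℤˣ)

theorem valid_starEdges {e : Segment} (he : e ∈ starEdges) : Valid (period 0) e := by
  rcases he with rfl | rfl | rfl | rfl <;>
    simp [Valid, period, coordSum, isUnit_I, isUnit_I.neg]

theorem parentIter_starEdges {e : Segment} (he : e ∈ starEdges) :
    parentIter period 1 8 e = e := by
  rcases he with rfl | rfl | rfl | rfl <;> rfl

theorem exists_sameCycle_starEdges {s : Segment} (hs : Valid (period 0) s) :
    ∃ e ∈ starEdges, (flow (toeplitz ω period) 1).SameCycle e s := by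
  obtain ⟨k, hk⟩ := exists_iterate_parentIter_mem (B := 5) (τ := period) (l := 1) odd_one
    (fun N a h1 h2 => by nlinarith [sq_nonneg (a - 2)])
    (fun N a h1 h2 => by nlinarith [sq_nonneg (a - 2)]) (n := 8) (by norm_num)
    (P := Valid (period 0)) (fun s h => h) (fun s h => valid_parentIter odd_one 8 h)
    (fun s h => parentIter_mem_starEdges h) hs
  exact ⟨_, hk, sameCycle_of_iterate ω odd_one shift_period hs (valid_starEdges hk)
    (parentIter_starEdges hk) rfl⟩

/-- The segments of the second covering, in the coordinates in which it is self-similar. -/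
def InCoset (s : Segment) : Prop :=
  Valid (period 0) s ∧ ∃ W, s.start = 3 * W + I

theorem exists_start_pow (σ : GaussianInt → ℤˣ) (l : ℤ) (k : ℕ) (s : Segment) :
    ∃ V, ((flow σ l ^ k) s).start = s.start + l * V := by
  induction k with
  | zero => exact ⟨0, by simp⟩
  | succ k ih =>
    obtain ⟨V, hV⟩ := ih
    refine ⟨V + ((flow σ l ^ k) s).dir, ?_⟩
    rw [pow_succ', Equiv.Perm.mul_apply]
    change ((flow σ l ^ k) s).start + l * ((flow σ l ^ k) s).dir = _
    rw [hV]; ring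

theorem start_subIter (τ : ℕ → ℤ) (n : ℕ) (p : Segment) :
    (subIter τ n p).start = (1 + I) ^ n * p.start := by
  induction n generalizing τ with
  | zero => simp [subIter]
  | succ n ih =>
    change (1 + I) * (subIter (shift τ) n p).start = _
    rw [ih]; ring

theorem three_odd : Odd (3 : ℤ) := by decide

theorem InCoset.parentIter {s : Segment} (h : InCoset s) : InCoset (parentIter period 3 8 s) := by
  refine ⟨valid_parentIter three_odd 8 h.1, ?_⟩
  obtain ⟨W, hW⟩ := h.2
  obtain ⟨a, -, ha⟩ := exists_pow_subIter 1 three_odd 8 h.1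
  obtain ⟨V, hV⟩ := exists_start_pow (toeplitz 1 period) 3 a
    (subIter period 8 (Paperfolding.parentIter period 3 8 s))
  rw [ha, start_subIter, hW, show (1 + I) ^ 8 = 16 by rfl] at hV
  -- From 3W + i = 16p + 3V and 16 = 1 + 3 · 5.
  refine ⟨W - V - 5 * (Paperfolding.parentIter period 3 8 s).start, ?_⟩
  push_cast at hV
  linear_combination -hV

theorem InCoset.pow {s : Segment} (h : InCoset s) (k : ℕ) :
    InCoset ((flow (toeplitz ω period) 3 ^ k) s) := by
  obtain ⟨W, hW⟩ := h.2
  obtain ⟨V, hV⟩ := exists_start_pow (toeplitz ω period) 3 k s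
  exact ⟨h.1.pow three_odd _ k, W + V, by rw [hV, hW]; push_cast; ring⟩

theorem exists_iterate_mem_fourEdges {s : Segment} (hs : InCoset s) :
    ∃ k, (parentIter period 3 8)^[k] s ∈ Set.range fourEdges := by
  refine exists_iterate_parentIter_mem (B := 52) three_odd ?_ ?_ (by norm_num) (P := InCoset)
    (fun s h => h.1) (fun s h => h.parentIter)
    (fun s h => parentIter_mem_range_fourEdges h.1 h.2) hs
  · intro N a h1 h2
    have : a ≤ 7 := by nlinarith
    linarith
  · intro N a h1 h2
    by_contra h3
    have : 8 ≤ a := by linarith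
    nlinarith

theorem exists_sameCycle_fourEdges {s : Segment} (hs : InCoset s) :
    ∃ j, (flow (toeplitz ω period) 3).SameCycle (fourEdges j) s := by
  obtain ⟨k, j, hj⟩ := exists_iterate_mem_fourEdges hs
  exact ⟨j, sameCycle_of_iterate ω three_odd shift_period hs.1 (valid_fourEdges j)
    (parentIter_fourEdges j) hj.symm⟩

theorem flow_fourEdges_ne (i j : Fin 4) :
    flow (toeplitz ω period) 3 (fourEdges i) ≠ fourEdges j := by
  have h1 : toeplitz ω period I = -1 := by
    rw [toeplitz_odd _ _ (by decide)]; rfl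
  have h2 : toeplitz ω period ⟨0, -2⟩ = -1 := by
    rw [show (⟨0, -2⟩ : GaussianInt) = (1 + I) * ((1 + I) * (-1)) by rfl, toeplitz_mul,
      toeplitz_mul, toeplitz_odd _ _ (by decide)]
    rfl
  have h3 : ∀ s, (flow (toeplitz ω period) 3 s).start = s.start + (3 : ℤ) * s.dir := fun s => rfl
  have h4 : ∀ s, (flow (toeplitz ω period) 3 s).dir =
    ((toeplitz ω period (s.start + (3 : ℤ) * s.dir) : ℤ) : GaussianInt) * I * s.dir := fun s => rfl
  intro h
  have h5 := congrArg Segment.start h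
  have h6 := congrArg Segment.dir h
  rw [h3] at h5
  rw [h4, ← h3, congrArg Segment.start h] at h6
  -- Only two ends meet an initial point: edge 1 ends at i, where edge 2 starts, and edge 2 ends at
  -- -2i, where edge 0 starts. In both cases the curve turns the other way.
  fin_cases i <;> fin_cases j <;> first | exact absurd h5 (by decide) | skip
  · change ((toeplitz ω period I : ℤ) : GaussianInt) * I * (-1) = -I at h6
    rw [h1] at h6
    exact absurd h6 (by decide)
  · change ((toeplitz ω period ⟨0, -2⟩ : ℤ) : GaussianInt) * I * (-I) = 1 at h6
    rw [h2] at h6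
    exact absurd h6 (by decide)

theorem fourEdges_injective : Function.Injective fourEdges := by
  intro i j h
  have := congrArg Segment.dir h
  fin_cases i <;> fin_cases j <;> first | rfl | exact absurd this (by decide)

theorem eq_of_sameCycle_fourEdges {i j : Fin 4}
    (h : (flow (toeplitz ω period) 3).SameCycle (fourEdges i) (fourEdges j)) : i = j := by
  by_contra h0
  exact not_sameCycle ω three_odd (by norm_num) shift_period (valid_fourEdges i)
    (valid_fourEdges j) (parentIter_fourEdges i) (parentIter_fourEdges j)
    (fun h => h0 (fourEdges_injective h)) (flow_fourEdges_ne ω i j) (flow_fourEdges_ne ω j i) h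

/-! ### Change of coordinates -/

/-- The image of a segment under `y ↦ l * u * y + c`, with the direction in the form `u * dir`. -/
def emb (l : ℤ) (u c : GaussianInt) (s : Segment) : Segment := ⟨l * u * s.start + c, u * s.dir⟩

theorem emb_flow (f : GaussianInt → ℤˣ) (l : ℤ) (u c : GaussianInt) (s : Segment) :
    emb l u c (flow (fun y => f (l * u * y + c)) 1 s) = flow f l (emb l u c s) := by
  have h : l * u * (s.start + (1 : ℤ) * s.dir) + c = l * u * s.start + c + l * (u * s.dir) := by
    push_cast; ring
  ext1
  · exact h
  · simp only [emb, flow, Equiv.coe_fn_mk, h]; ring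

theorem emb_zpow (f : GaussianInt → ℤˣ) (l : ℤ) (u c : GaussianInt) (s : Segment) (k : ℤ) :
    emb l u c ((flow (fun y => f (l * u * y + c)) 1 ^ k) s) = (flow f l ^ k) (emb l u c s) := by
  induction k using Int.induction_on with
  | zero => rfl
  | succ k ih =>
    rw [add_comm, zpow_add, zpow_add, Equiv.Perm.mul_apply, Equiv.Perm.mul_apply, ← ih]
    exact emb_flow f l u c _
  | pred k ih =>
    rw [sub_eq_add_neg, add_comm, zpow_add, zpow_add, Equiv.Perm.mul_apply, Equiv.Perm.mul_apply,
      ← ih, zpow_neg_one, zpow_neg_one, Equiv.Perm.eq_inv_iff_eq, ← emb_flow]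
    congr 1
    exact Equiv.apply_symm_apply _ _

theorem emb_injective {l : ℤ} (hl : Odd l) {u : GaussianInt} (hu : IsUnit u) (c : GaussianInt) :
    Function.Injective (emb l u c) := by
  intro s t h
  have h1 : l * u * s.start + c = l * u * t.start + c := congrArg Segment.start h
  have h2 : u * s.dir = u * t.dir := congrArg Segment.dir h
  have hl' : (l : GaussianInt) ≠ 0 := by
    rw [Int.cast_ne_zero]; rintro rfl; exact absurd hl (by decide)
  ext1
  · exact mul_left_cancel₀ (mul_ne_zero hl' hu.ne_zero) (add_right_cancel h1)
  · exact mul_left_cancel₀ hu.ne_zero h2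

/-- The parity of the orientation in the original coordinates. -/
def orient (u c : GaussianInt) : ℤ := coordSum c + period 0 + u.im

theorem valid_emb {l : ℤ} (hl : Odd l) {u : GaussianInt} (hu : IsUnit u) (c : GaussianInt)
    (s : Segment) : Valid (period 0) (emb l u c s) ↔ Valid (orient u c) s := by
  unfold Valid
  have h1 : IsUnit (emb l u c s).dir ↔ IsUnit s.dir := by
    simp [emb, IsUnit.mul_iff, hu]
  rw [h1]
  refine and_congr_right fun hd => ?_
  have h2 : coordSum (emb l u c s).start = l * coordSum (u * s.start) + coordSum c := by
    simp only [emb]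
    rw [coordSum_add, mul_assoc, coordSum_intCast_mul]
  have h3 : Even (coordSum (u * s.start)) ↔ Even (coordSum s.start) := by
    rcases isUnit_cases hu with rfl | rfl | rfl | rfl <;>
      simp [coordSum, Int.even_add] <;> tauto
  have h4 : (emb l u c s).dir.im = 0 ↔ (s.dir.im = 0 ↔ u.im = 0) := by
    simp only [emb]
    rcases isUnit_cases hu with rfl | rfl | rfl | rfl <;>
      rcases isUnit_cases hd with h | h | h | h <;> simp [h]
  have h5 : Even u.im ↔ u.im = 0 := by
    rcases isUnit_cases hu with rfl | rfl | rfl | rfl <;> simp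
  rw [h2, h4]
  have hl' := Int.not_even_iff_odd.2 hl
  simp only [orient, Int.even_add, Int.even_mul, h3, h5, hl', false_or]
  tauto

/-! ### Coverings described by the turns at the vertices -/

/-- `𝒞` consists of all segments with the right orientation, and turns by `σ` at the vertices. -/
structure Describes (𝒞 : Set CompleteCurve) (σ : GaussianInt → ℤˣ) (q : ℤ) : Prop where
  mem_segments : ∀ s, s ∈ segments 𝒞 ↔ Valid q s
  consecutive : ∀ s t, Consecutive 𝒞 s t ↔ Valid q s ∧ flow σ 1 s = t

theorem coordSum_translate (s : Segment) (v : GaussianInt) :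
    coordSum (s.translate v).start = coordSum s.start + coordSum v := coordSum_add _ _

/-- A finite pattern is determined by the orientation parity and by the signs at the ends of its
segments, so a translation respecting these data is enough. -/
theorem Describes.patternsAppearIn {𝒞 𝒟 : Set CompleteCurve} {σ σ' : GaussianInt → ℤˣ} {q q' : ℤ}
    (h : Describes 𝒞 σ q) (h' : Describes 𝒟 σ' q')
    (H : ∀ B : Set GaussianInt, B.Finite → ∃ v, Even (coordSum v + q + q') ∧
      ∀ y ∈ B, σ' (y + v) = σ y) : PatternsAppearIn 𝒞 𝒟 := by
  intro F hF hF'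
  obtain ⟨v, hv, hB⟩ := H _ (hF.image fun s => s.start + s.dir)
  have hval : ∀ s, Valid q s ↔ Valid q' (s.translate v) := by
    intro s
    unfold Valid
    rw [coordSum_translate]
    refine and_congr_right fun _ => ?_
    simp only [Segment.translate, Int.even_add] at hv ⊢
    tauto
  refine ⟨v, fun s hs => ?_, fun s hs t _ => ?_⟩
  · rw [h'.mem_segments, ← hval, ← h.mem_segments]
    exact hF' hs
  · rw [h.consecutive, h'.consecutive, ← hval]
    refine and_congr_right fun _ => ?_
    have h1 := hB _ (Set.mem_image_of_mem _ hs)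
    have h2 : flow σ' 1 (s.translate v) = (flow σ 1 s).translate v := by
      have h3 : s.start + v + (1 : ℤ) * s.dir = s.start + s.dir + v := by push_cast; ring
      have h4 : s.start + (1 : ℤ) * s.dir = s.start + s.dir := by push_cast; ring
      simp only [flow, Segment.translate, Equiv.coe_fn_mk, h3, h4, h1]
    rw [h2]
    constructor
    · rintro rfl; rfl
    · intro h
      ext1
      · have h3 := congrArg Segment.start h
        exact add_right_cancel h3
      · have h3 := congrArg Segment.dir h
        exact h3

/-- The curve through `s`. -/
def orbit (σ : GaussianInt → ℤˣ) (s : Segment) (hs : IsUnit s.dir) : CompleteCurve where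
  turn k := σ ((flow σ 1 ^ (k + 1)) s).start
  start k := ((flow σ 1 ^ k) s).start
  dir k := ((flow σ 1 ^ k) s).dir
  isUnit_dir k := by
    have hv : Valid (coordSum s.start + if s.dir.im = 0 then 0 else 1) s := by
      refine ⟨hs, ?_⟩
      rw [← add_assoc]
      split_ifs with h
      · simp [h]
      · simp [h]
    exact (hv.zpow odd_one σ k).1
  start_succ k := by
    rw [add_comm, zpow_add, zpow_one, Equiv.Perm.mul_apply]
    simp [flow]
  dir_succ k := by
    rw [add_comm, zpow_add, zpow_one, Equiv.Perm.mul_apply]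
    simp [flow]

theorem orbit_seg (σ : GaussianInt → ℤˣ) (s : Segment) (hs : IsUnit s.dir) (k : ℤ) :
    (orbit σ s hs).seg k = (flow σ 1 ^ k) s := rfl

theorem reverse_reverse (s : Segment) : s.reverse.reverse = s := by
  ext1 <;> simp [Segment.reverse]

/-- Exactly one of the orientations of a segment is the right one. -/
theorem valid_reverse {q : ℤ} {s : Segment} (hs : IsUnit s.dir) :
    Valid q s.reverse ↔ ¬ Valid q s := by
  unfold Valid
  have h1 := Int.not_even_iff_odd.2 (odd_coordSum hs)
  simp only [Segment.reverse, IsUnit.neg_iff, hs, true_and, Zsqrtd.im_neg, neg_eq_zero,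
    coordSum_add, Int.even_add]
  tauto

theorem coherent_of_valid {𝒞 : Set CompleteCurve} {q : ℤ} (h : ∀ s ∈ segments 𝒞, Valid q s) :
    Coherent 𝒞 :=
  ⟨q, fun s hs => (h s hs).2⟩

/-! ### Coverings built from one representative of each orbit -/

section Family

variable {ι : Type*} {σ : GaussianInt → ℤˣ} {q : ℤ} {e : ι → Segment}
  (hv : ∀ j, Valid q (e j)) (he : ∀ s, Valid q s → ∃ j, (flow σ 1).SameCycle (e j) s)
  (hinj : ∀ i j, (flow σ 1).SameCycle (e i) (e j) → i = j)
  (hper : ∀ s, Valid q s → Function.Injective fun k : ℤ => (flow σ 1 ^ k) s)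

include he in
theorem describes_range_orbit :
    Describes (Set.range fun j => orbit σ (e j) (hv j).1) σ q where
  mem_segments s := by
    constructor
    · rintro ⟨_, ⟨j, rfl⟩, k, rfl⟩
      exact (hv j).zpow odd_one σ k
    · intro hs
      obtain ⟨j, k, hk⟩ := he s hs
      exact ⟨_, ⟨j, rfl⟩, k, hk⟩
  consecutive s t := by
    have h1 : ∀ s (k : ℤ), (flow σ 1 ^ (k + 1)) s = flow σ 1 ((flow σ 1 ^ k) s) := fun s k => by
      rw [add_comm, zpow_add, zpow_one, Equiv.Perm.mul_apply]
    constructor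
    · rintro ⟨_, ⟨j, rfl⟩, k, rfl, rfl⟩
      exact ⟨(hv j).zpow odd_one σ k, (h1 _ _).symm⟩
    · rintro ⟨hs, rfl⟩
      obtain ⟨j, k, rfl⟩ := he s hs
      exact ⟨_, ⟨j, rfl⟩, k, rfl, h1 _ _⟩

include hinj hper in
theorem eq_of_orbit_seg_eq {i j : ι} {k m : ℤ}
    (h : (orbit σ (e i) (hv i).1).seg k = (orbit σ (e j) (hv j).1).seg m) : i = j ∧ k = m := by
  obtain rfl : i = j := hinj i j (Equiv.Perm.SameCycle.trans ⟨k, rfl⟩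
    (Equiv.Perm.SameCycle.symm ⟨m, h.symm⟩))
  exact ⟨rfl, hper _ (hv i) h⟩

include he hinj hper in
theorem covers_range_orbit : Covers (Set.range fun j => orbit σ (e j) (hv j).1) := by
  intro z ε hε
  have hu : IsUnit ε := by rcases hε with rfl | rfl; exacts [isUnit_one, isUnit_I]
  obtain ⟨s, hs, hs', hsv⟩ : ∃ s : Segment, (s = ⟨z, ε⟩ ∨ s = Segment.reverse ⟨z, ε⟩) ∧
      (∀ t : Segment, (t = ⟨z, ε⟩ ∨ t = Segment.reverse ⟨z, ε⟩) → t = s ∨ t = s.reverse) ∧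
      Valid q s := by
    by_cases h : Valid q ⟨z, ε⟩
    · exact ⟨_, Or.inl rfl, fun t ht => ht, h⟩
    · refine ⟨_, Or.inr rfl, fun t ht => ?_, (valid_reverse hu).2 h⟩
      rw [reverse_reverse]; exact ht.symm
  obtain ⟨j, k, hk⟩ := he s hsv
  refine ⟨(orbit σ (e j) (hv j).1, k), ⟨⟨j, rfl⟩, ?_⟩, ?_⟩
  · rwa [orbit_seg, hk]
  · rintro ⟨_, m⟩ ⟨⟨i, rfl⟩, hm⟩
    have hvi : Valid q ((orbit σ (e i) (hv i).1).seg m) := (hv i).zpow odd_one σ m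
    rcases hs' _ hm with h | h
    · obtain ⟨rfl, rfl⟩ := eq_of_orbit_seg_eq hv hinj hper (h.trans hk.symm)
      rfl
    · simp only at h
      rw [h, valid_reverse hsv.1] at hvi
      exact absurd hsv hvi

include hinj hper in
theorem orbit_injective : Function.Injective fun j => orbit σ (e j) (hv j).1 := by
  intro i j h
  exact (eq_of_orbit_seg_eq hv hinj hper (k := 0) (m := 0)
    (congrArg (fun γ => CompleteCurve.seg γ 0) h)).1

end Family

end

section

/-! ### The covering by four curves -/

theorem inCoset_fourEdges (j : Fin 4) : InCoset (fourEdges j) := by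
  refine ⟨valid_fourEdges j, ?_⟩
  fin_cases j
  exacts [⟨-I, rfl⟩, ⟨1, rfl⟩, ⟨0, rfl⟩, ⟨-1 - I, rfl⟩]

theorem inCoset_emb {u : GaussianInt} (hu : IsUnit u) {s : Segment} (hs : Valid (orient u I) s) :
    InCoset (emb 3 u I s) :=
  ⟨(valid_emb three_odd hu I s).2 hs, u * s.start, by simp only [emb]; push_cast; ring⟩

theorem InCoset.exists_emb {u : GaussianInt} (hu : IsUnit u) {s : Segment} (hs : InCoset s) :
    ∃ t, emb 3 u I t = s := by
  obtain ⟨v, hv⟩ := hu.exists_right_inv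
  obtain ⟨W, hW⟩ := hs.2
  refine ⟨⟨v * W, v * s.dir⟩, ?_⟩
  ext1
  · simp only [emb, hW]; push_cast; linear_combination 3 * W * hv
  · simp only [emb]; linear_combination s.dir * hv

theorem isFolding_block_fourEdges {s : Segment} (hs : InCoset s) (m : ℕ) :
    ∃ (N : ℕ) (T : List ℤˣ), IsFolding N T ∧
      (List.ofFn fun j : Fin m =>
        toeplitz 1 period ((flow (toeplitz 1 period) 3 ^ ((j : ℕ) + 1)) s).start) <:+: T := by
  refine isFolding_block 1 three_odd shift_period (A := Set.range fourEdges) ?_ ?_ ?_ hs.1 ?_ m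
  · rintro _ ⟨j, rfl⟩; exact valid_fourEdges j
  · rintro _ ⟨j, rfl⟩; exact parentIter_fourEdges j
  · rintro _ ⟨i, rfl⟩ _ ⟨j, rfl⟩ h
    rw [eq_of_sameCycle_fourEdges 1 h]
  · exact fun m => exists_iterate_mem_fourEdges (hs.pow 1 m)

/-- The coset 3ℤ[i] + i is rescaled to unit edges. It does not contain 0, so the value 1 given to ω
plays no role. -/
theorem exists_covering_four {u : GaussianInt} (hu : IsUnit u) :
    ∃ 𝒟, IsFoldingCovering 𝒟 ∧ 𝒟.ncard = 4 ∧
      Describes 𝒟 (fun y => toeplitz 1 period ((3 : ℤ) * u * y + I)) (orient u I) := by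
  choose e he using fun j => (inCoset_fourEdges j).exists_emb hu
  set σ : GaussianInt → ℤˣ := fun y => toeplitz 1 period ((3 : ℤ) * u * y + I) with hσ
  have hz : ∀ s (k : ℤ), emb 3 u I ((flow σ 1 ^ k) s) =
      (flow (toeplitz 1 period) 3 ^ k) (emb 3 u I s) := fun s k => emb_zpow _ _ _ _ s k
  have hv : ∀ j, Valid (orient u I) (e j) := fun j => by
    rw [← valid_emb three_odd hu, he]; exact valid_fourEdges j
  have hall : ∀ s, Valid (orient u I) s → ∃ j, (flow σ 1).SameCycle (e j) s := by
    intro s hs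
    obtain ⟨j, k, hk⟩ := exists_sameCycle_fourEdges 1 (inCoset_emb hu hs)
    rw [← he, ← hz] at hk
    exact ⟨j, k, emb_injective three_odd hu I hk⟩
  have hinj : ∀ i j, (flow σ 1).SameCycle (e i) (e j) → i = j := by
    rintro i j ⟨k, hk⟩
    refine eq_of_sameCycle_fourEdges 1 ⟨k, ?_⟩
    rw [← he, ← he, ← hz, hk]
  have hper : ∀ s, Valid (orient u I) s → Function.Injective fun k : ℤ => (flow σ 1 ^ k) s := by
    intro s hs k m hkm
    have h1 := congrArg (emb 3 u I) hkm
    simp only [hz] at h1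
    exact zpow_injective 1 three_odd ((valid_emb three_odd hu I s).2 hs) h1
  have hD := describes_range_orbit hv hall
  refine ⟨_, ⟨covers_range_orbit hv hall hinj hper,
    coherent_of_valid fun s hs => (hD.mem_segments s).1 hs, ?_⟩, ?_, hD⟩
  · rintro _ ⟨j, rfl⟩ k m
    have h1 : InCoset (emb 3 u I ((flow σ 1 ^ (k + 1)) (e j))) :=
      inCoset_emb hu ((hv j).zpow odd_one σ (k + 1))
    convert isFolding_block_fourEdges h1 m using 7 with N T
    funext i
    have h2 : (flow σ 1 ^ (k + 1 + (i : ℕ) + 1)) (e j) =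
        (flow σ 1 ^ (((i : ℕ) + 1 : ℕ) : ℤ)) ((flow σ 1 ^ (k + 1)) (e j)) := by
      rw [← Equiv.Perm.mul_apply, ← zpow_add]
      congr 2; push_cast; ring
    rw [← zpow_natCast, ← hz, ← h2]
    rfl
  · rw [← Set.image_univ, Set.ncard_image_of_injective _ (orbit_injective hv hinj hper),
      Set.ncard_univ, Nat.card_eq_fintype_card, Fintype.card_fin]

/-! ### The turns of the generating curve -/

theorem Folds.two_pow {g : ℕ → ℤˣ} (h : Folds fun k => g (k + 1)) (n : ℕ) :
    Folds fun k => g (2 ^ n * (k + 1)) := by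
  induction n with
  | zero => simpa using h
  | succ n ih =>
    convert ih.odd using 3 with k
    ring

theorem Folds.apply_odd {g : ℕ → ℤˣ} (h : Folds fun k => g (k + 1)) (n k : ℕ) :
    g (2 ^ n * (2 * k + 1)) = (-1) ^ k * g (2 ^ n) := by
  simpa using (h.two_pow n).even k

theorem iterate_shift_apply (τ : ℕ → ℤ) (n k : ℕ) : (shift^[n] τ) k = τ (n + k) := by
  induction n generalizing τ with
  | zero => simp
  | succ n ih => rw [Function.iterate_succ_apply, ih]; simp only [shift]; congr 1; ring

variable (ω : ℤˣ)

/-- A valid edge leaving 0 is horizontal, that is, has odd real part, exactly when τ 0 is even. So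
re d + 1 has the parity of τ 0. -/
theorem toeplitz_unit {τ : ℕ → ℤ} {p : Segment} (h : Valid (τ 0) p) (h0 : p.start = 0) :
    toeplitz ω τ (flow (toeplitz ω τ) 1 p).start = Int.negOnePow (τ 0 + τ 1) := by
  have h1 : (flow (toeplitz ω τ) 1 p).start = p.dir := by
    change p.start + (1 : ℤ) * p.dir = p.dir
    simp [h0]
  rw [h1, toeplitz_odd _ _ (odd_coordSum h.1), Int.negOnePow_eq_iff]
  have h2 := h.2
  rw [h0] at h2
  have h3 : Even p.dir.re ↔ ¬ p.dir.im = 0 := by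
    rcases isUnit_cases h.1 with h | h | h | h <;> simp [h]
  have h4 : Even (coordSum 0 + τ 0) ↔ Even (τ 0) := by simp [coordSum]
  rw [h4] at h2
  simp only [Int.even_sub, Int.even_add, h3, h2, Int.not_even_one]
  tauto

/-- Both sides obey the same recursion: for odd k they alternate from the value at a power of 2, and
an even k is halved while τ is shifted. -/
theorem turn_eq {g : ℕ → ℤˣ} (h : Folds fun k => g (k + 1)) {τ₀ : ℕ → ℤ}
    (hg : ∀ n, g (2 ^ n) = Int.negOnePow (τ₀ n + τ₀ (n + 1))) {k : ℕ} (hk : 0 < k) (n : ℕ)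
    {p : Segment} (hp : Valid ((shift^[n] τ₀) 0) p) (h0 : p.start = 0) :
    toeplitz ω (shift^[n] τ₀) ((flow (toeplitz ω (shift^[n] τ₀)) 1 ^ k) p).start =
      g (2 ^ n * k) := by
  induction k using Nat.strong_induction_on generalizing n p with
  | _ k ih =>
    have hup := valid_up (τ := shift^[n] τ₀) hp.1
    have hsub : sub (shift^[n] τ₀) (up (shift^[n] τ₀) p) = p :=
      sub_up hp (by rw [h0]; exact Even.zero)
    rcases Nat.even_or_odd' k with ⟨j, rfl | rfl⟩
    · have h1 := turn_sub_even ω odd_one hup j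
      rw [hsub] at h1
      rw [h1]
      have h2 : shift (shift^[n] τ₀) = shift^[n + 1] τ₀ := (Function.iterate_succ_apply' _ _ _).symm
      rw [h2, ih j (by omega) (by omega) (n + 1)]
      · congr 1; ring
      · rw [← h2]; exact hup
      · simp [up, h0, half]; rfl
    · have h1 := turn_sub_odd ω odd_one hup j
      rw [hsub] at h1
      rw [h1, h.apply_odd, hg, pow_one, toeplitz_unit ω hp h0, iterate_shift_apply,
        iterate_shift_apply, add_zero]

/-- The curve issued from 0 never comes back to 0: after an odd number of steps the vertex is odd,
and an even number is halved. So ω does not influence it. -/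
theorem start_pow_ne_zero {τ : ℕ → ℤ} {p : Segment} (hp : Valid (τ 0) p) (h0 : p.start = 0)
    {k : ℕ} (hk : 0 < k) : ((flow (toeplitz ω τ) 1 ^ k) p).start ≠ 0 := by
  induction k using Nat.strong_induction_on generalizing τ p with
  | _ k ih =>
    have hup := valid_up (τ := τ) hp.1
    have hsub : sub τ (up τ p) = p := sub_up hp (by rw [h0]; exact Even.zero)
    rcases Nat.even_or_odd' k with ⟨j, rfl | rfl⟩
    · have h1 := pow_two_mul_sub ω odd_one hup j
      rw [hsub] at h1
      rw [h1]
      exact mul_ne_zero one_add_I_ne_zero (ih j (by omega) (τ := shift τ) hup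
        (by simp [up, h0, half]; rfl) (by omega))
    · have h1 := pow_two_mul_sub ω odd_one hup j
      rw [hsub] at h1
      rw [add_comm, pow_add, pow_one, Equiv.Perm.mul_apply, h1]
      intro h2
      have h3 := odd_mid odd_one (valid_sub (τ := τ) (hup.pow odd_one
        (toeplitz ω (shift τ)) j)).1 ((flow (toeplitz ω (shift τ)) 1 ^ j) (up τ p)).start
      have h4 : (flow (toeplitz ω τ) 1 (sub τ ((flow (toeplitz ω (shift τ)) 1 ^ j)
        (up τ p)))).start = (1 + I) * ((flow (toeplitz ω (shift τ)) 1 ^ j) (up τ p)).start +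
          (1 : ℤ) * (sub τ ((flow (toeplitz ω (shift τ)) 1 ^ j) (up τ p))).dir := rfl
      rw [← h4, h2] at h3
      exact absurd h3 (by decide)

end

/-! ### The generated covering -/

theorem InftyCurve.emb_seg {S : ℕ+ → ℤˣ} {H : InftyCurve} (hH : H.turn = S) {u : GaussianInt}
    (hu : u * H.dir 1 = 1) (ω : ℤˣ)
    (hturn : ∀ k : ℕ, toeplitz ω period ((flow (toeplitz ω period) 1 ^ (k + 1)) ⟨0, 1⟩).start =
      S k.succPNat) (k : ℕ) :
    emb 1 u (-u * H.start 1) (H.seg k.succPNat) = (flow (toeplitz ω period) 1 ^ k) ⟨0, 1⟩ := by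
  induction k with
  | zero =>
    ext1
    · change ((1 : ℤ) : GaussianInt) * u * H.start 1 + -u * H.start 1 = 0
      push_cast; ring
    · exact hu
  | succ k ih =>
    have h1 : (k + 1).succPNat = k.succPNat + 1 := rfl
    have h2 := hturn k
    rw [pow_succ', Equiv.Perm.mul_apply] at h2 ⊢
    rw [← ih] at h2 ⊢
    have h3 : (emb 1 u (-u * H.start 1) (H.seg (k + 1).succPNat)).start =
        (flow (toeplitz ω period) 1 (emb 1 u (-u * H.start 1) (H.seg k.succPNat))).start := by
      simp only [emb, InftyCurve.seg, h1, H.start_succ, flow, Equiv.coe_fn_mk]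
      push_cast; ring
    ext1
    · exact h3
    · have h4 : (flow (toeplitz ω period) 1 (emb 1 u (-u * H.start 1) (H.seg k.succPNat))).dir =
        ((toeplitz ω period (flow (toeplitz ω period) 1
          (emb 1 u (-u * H.start 1) (H.seg k.succPNat))).start : ℤ) : GaussianInt) * I *
          (u * H.dir k.succPNat) := rfl
      rw [h4, h2]
      simp only [emb, InftyCurve.seg, h1, H.dir_succ, hH]
      ring

/-- The image of a segment under the rotation of angle `j * π / 2` around the origin. -/
def Segment.rot (j : ℕ) (s : Segment) : Segment := ⟨I ^ j * s.start, I ^ j * s.dir⟩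

theorem emb_rotate (H : InftyCurve) (u : GaussianInt) (j : ℕ) (k : ℕ+) :
    emb 1 u (-u * H.start 1) ((H.rotate j).seg k) =
      (emb 1 u (-u * H.start 1) (H.seg k)).rot j := by
  ext1 <;> simp only [emb, InftyCurve.seg, InftyCurve.rotate, Segment.rot] <;> push_cast <;> ring

theorem emb_reverse (u c : GaussianInt) (s : Segment) :
    emb 1 u c s.reverse = (emb 1 u c s).reverse := by
  ext1 <;> simp only [emb, Segment.reverse] <;> push_cast <;> ring

theorem toeplitz_I_pow_mul (ω : ℤˣ) (τ : ℕ → ℤ) {Z : GaussianInt} (hZ : Z ≠ 0) (j : ℕ) :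
    toeplitz ω τ (I ^ j * Z) = (-1) ^ j * toeplitz ω τ Z := by
  induction j with
  | zero => simp
  | succ j ih =>
    rw [pow_succ', mul_assoc, toeplitz_I_mul _ _ (mul_ne_zero (isUnit_I.pow j).ne_zero hZ), ih,
      pow_succ']
    simp

theorem flow_rot {ω : ℤˣ} {τ : ℕ → ℤ} {j : ℕ} (hj : Even j) {s : Segment}
    (h : (flow (toeplitz ω τ) 1 s).start ≠ 0) :
    flow (toeplitz ω τ) 1 (s.rot j) = (flow (toeplitz ω τ) 1 s).rot j := by
  have h1 : (s.rot j).start + (1 : ℤ) * (s.rot j).dir =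
      I ^ j * (flow (toeplitz ω τ) 1 s).start := by
    simp only [Segment.rot, flow, Equiv.coe_fn_mk]; ring
  have h2 : (flow (toeplitz ω τ) 1 (s.rot j)).dir =
    ((toeplitz ω τ ((s.rot j).start + (1 : ℤ) * (s.rot j).dir) : ℤ) : GaussianInt) * I *
      (I ^ j * s.dir) := rfl
  ext1
  · exact h1
  · rw [h2, h1, toeplitz_I_pow_mul _ _ h, hj.neg_one_pow, one_mul]
    simp only [Segment.rot, flow, Equiv.coe_fn_mk]; ring

/-- An odd number of quarter turns negates the signs away from 0, and so does travelling backwards.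
The two effects cancel. -/
theorem flow_reverse_rot {ω : ℤˣ} {τ : ℕ → ℤ} {j : ℕ} (hj : Odd j) {s : Segment}
    (h : (flow (toeplitz ω τ) 1 s).start ≠ 0) :
    flow (toeplitz ω τ) 1 ((flow (toeplitz ω τ) 1 s).rot j).reverse = (s.rot j).reverse := by
  set t := flow (toeplitz ω τ) 1 s with ht
  have h0 : t.start = s.start + (1 : ℤ) * s.dir := rfl
  have h0' : t.dir = ((toeplitz ω τ t.start : ℤ) : GaussianInt) * I * s.dir := rfl
  have h1 : (t.rot j).reverse.start + (1 : ℤ) * (t.rot j).reverse.dir = I ^ j * t.start := by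
    simp only [Segment.rot, Segment.reverse]; push_cast; ring
  have h2 : (flow (toeplitz ω τ) 1 (t.rot j).reverse).dir =
    ((toeplitz ω τ ((t.rot j).reverse.start + (1 : ℤ) * (t.rot j).reverse.dir) : ℤ) :
      GaussianInt) * I * -(I ^ j * t.dir) := rfl
  ext1
  · refine h1.trans ?_
    rw [h0]
    simp only [Segment.rot, Segment.reverse]; push_cast; ring
  · rw [h2, h1, toeplitz_I_pow_mul _ _ h, hj.neg_one_pow, neg_one_mul, h0']
    have h3 := intUnit_mul_self (toeplitz ω τ t.start)
    simp only [Segment.rot, Segment.reverse]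
    push_cast
    linear_combination I ^ j * s.dir * ((toeplitz ω τ t.start : ℤ) : GaussianInt) ^ 2 * I_mul_I -
      I ^ j * s.dir * h3

/-- The curves through the common origin of the four copies of `H` follow the flow. -/
theorem CompleteCurve.Connects.flow_emb {H : InftyCurve} {u : GaussianInt} {ω : ℤˣ}
    (hseg : ∀ k : ℕ, emb 1 u (-u * H.start 1) (H.seg k.succPNat) =
      (flow (toeplitz ω period) 1 ^ k) ⟨0, 1⟩) {γ : CompleteCurve} {a b : ℕ} (ha : Odd a)
    (hb : Even b) (hγ : γ.Connects (H.rotate a) (H.rotate b))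
    (hab : ((ω : ℤ) : GaussianInt) * I * -I ^ a = I ^ b) :
    (∀ k, flow (toeplitz ω period) 1 (emb 1 u (-u * H.start 1) (γ.seg k)) =
      emb 1 u (-u * H.start 1) (γ.seg (k + 1))) ∧
    (∃ k, emb 1 u (-u * H.start 1) (γ.seg k) = ⟨0, I ^ b⟩) ∧
    ∃ k, emb 1 u (-u * H.start 1) (γ.seg k) = ⟨I ^ a, -I ^ a⟩ := by
  obtain ⟨m, hm⟩ := hγ
  have hv : Valid (period 0) ⟨0, 1⟩ := by simp [Valid, period, coordSum]
  have hne : ∀ n : ℕ, (flow (toeplitz ω period) 1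
      ((flow (toeplitz ω period) 1 ^ n) ⟨0, 1⟩)).start ≠ 0 := by
    intro n
    rw [← Equiv.Perm.mul_apply, ← pow_succ']
    exact start_pow_ne_zero ω hv rfl n.succ_pos
  have h1 : ∀ n : ℕ, emb 1 u (-u * H.start 1) (γ.seg (m + 1 + n)) =
      ((flow (toeplitz ω period) 1 ^ n) ⟨0, 1⟩).rot b := by
    intro n
    have := (hm n.succPNat).1
    rw [show m + ((n.succPNat : ℕ) : ℤ) = m + 1 + n by simp; ring] at this
    rw [this, emb_rotate, hseg]
  have h2 : ∀ n : ℕ, emb 1 u (-u * H.start 1) (γ.seg (m - n)) =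
      (((flow (toeplitz ω period) 1 ^ n) ⟨0, 1⟩).rot a).reverse := by
    intro n
    have := (hm n.succPNat).2
    rw [show m + 1 - ((n.succPNat : ℕ) : ℤ) = m - n by simp] at this
    rw [this, emb_reverse, emb_rotate, hseg]
  have h3 := h1 0
  have h4 := h2 0
  simp only [Nat.cast_zero, add_zero, sub_zero, pow_zero, Equiv.Perm.one_apply] at h3 h4
  refine ⟨fun k => ?_, ⟨m + 1, ?_⟩, m, ?_⟩
  · rcases lt_trichotomy k m with hk | rfl | hk
    · obtain ⟨n, hn⟩ := Int.le.dest (Int.add_one_le_iff.2 hk)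
      obtain rfl : k = m - (n + 1 : ℕ) := by push_cast; linarith
      rw [h2, show m - ((n + 1 : ℕ) : ℤ) + 1 = m - n by push_cast; ring, h2, pow_succ',
        Equiv.Perm.mul_apply]
      exact flow_reverse_rot ha (hne n)
    · rw [h3, h4]
      have h5 : (Segment.rot a ⟨0, 1⟩).reverse.start +
          (1 : ℤ) * (Segment.rot a ⟨0, 1⟩).reverse.dir = 0 := by
        simp [Segment.rot, Segment.reverse]
      ext1
      · exact h5.trans (by simp [Segment.rot])
      · change ((toeplitz ω period ((Segment.rot a ⟨0, 1⟩).reverse.start +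
          (1 : ℤ) * (Segment.rot a ⟨0, 1⟩).reverse.dir) : ℤ) : GaussianInt) * I *
            -(I ^ a * 1) = I ^ b * 1
        -- At the origin the turn is ω, and `hab` says that it leads from the incoming direction
        -- -i^a to the outgoing one i^b.
        rw [h5, toeplitz_zero, mul_one, mul_one, hab]
    · obtain ⟨n, hn⟩ := Int.le.dest (Int.add_one_le_iff.2 hk)
      obtain rfl : k = m + 1 + n := hn.symm
      rw [h1, show m + 1 + (n : ℤ) + 1 = m + 1 + ((n + 1 : ℕ) : ℤ) by push_cast; ring, h1,
        pow_succ', Equiv.Perm.mul_apply]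
      exact flow_rot hb (hne n)
  · rw [h3]; simp [Segment.rot]
  · rw [h4]; simp [Segment.rot, Segment.reverse]

theorem seg_add_of_flow {γ : CompleteCurve} {σ : GaussianInt → ℤˣ}
    (h : ∀ k, flow σ 1 (γ.seg k) = γ.seg (k + 1)) (k j : ℤ) :
    γ.seg (k + j) = (flow σ 1 ^ j) (γ.seg k) := by
  induction j using Int.induction_on with
  | zero => simp
  | succ j ih =>
    rw [← add_assoc, ← h, ih, add_comm (j : ℤ), zpow_add, zpow_one, Equiv.Perm.mul_apply]
  | pred j ih =>
    rw [sub_eq_add_neg, add_comm (-(j : ℤ)), zpow_add, Equiv.Perm.mul_apply, ← ih, zpow_neg_one,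
      Equiv.Perm.eq_inv_iff_eq, h]
    congr 1; ring

/-- A covering consists of the curves of any subset which covers all segments. -/
theorem Covers.eq_of_subset {𝒞 G : Set CompleteCurve} (h : Covers 𝒞) (hG : G ⊆ 𝒞) {q : ℤ}
    (hall : ∀ s, Valid q s → ∃ γ ∈ G, ∃ k, γ.seg k = s) : 𝒞 = G := by
  refine Set.Subset.antisymm (fun γ hγ => ?_) hG
  have hu : IsUnit (γ.seg 0).dir := γ.isUnit_dir 0
  obtain ⟨z, ε, hε, hz⟩ : ∃ z ε, (ε = 1 ∨ ε = I) ∧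
      (γ.seg 0 = ⟨z, ε⟩ ∨ γ.seg 0 = Segment.reverse ⟨z, ε⟩) := by
    rcases isUnit_cases hu with h | h | h | h
    · exact ⟨_, _, Or.inl rfl, Or.inl (Segment.ext rfl h)⟩
    · exact ⟨(γ.seg 0).start - 1, 1, Or.inl rfl, Or.inr (Segment.ext (by simp [Segment.reverse]) h)⟩
    · exact ⟨_, _, Or.inr rfl, Or.inl (Segment.ext rfl h)⟩
    · exact ⟨(γ.seg 0).start - I, I, Or.inr rfl, Or.inr (Segment.ext (by simp [Segment.reverse]) h)⟩
  have hεu : IsUnit ε := by rcases hε with rfl | rfl; exacts [isUnit_one, isUnit_I]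
  obtain ⟨δ, hδ, k, hk⟩ : ∃ δ ∈ G, ∃ k : ℤ,
      δ.seg k = ⟨z, ε⟩ ∨ δ.seg k = Segment.reverse ⟨z, ε⟩ := by
    by_cases hv : Valid q ⟨z, ε⟩
    · obtain ⟨δ, hδ, k, hk⟩ := hall _ hv
      exact ⟨δ, hδ, k, Or.inl hk⟩
    · obtain ⟨δ, hδ, k, hk⟩ := hall _ ((valid_reverse hεu).2 hv)
      exact ⟨δ, hδ, k, Or.inr hk⟩
  have h1 := (h z ε hε).unique (y₁ := (γ, 0)) (y₂ := (δ, k)) ⟨hγ, hz⟩ ⟨hG hδ, hk⟩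
  obtain rfl : γ = δ := congrArg Prod.fst h1
  exact hδ

theorem describes_of_flow {G : Set CompleteCurve} {σ : GaussianInt → ℤˣ} {q : ℤ}
    (hv : ∀ γ ∈ G, ∀ k, Valid q (γ.seg k))
    (hf : ∀ γ ∈ G, ∀ k, flow σ 1 (γ.seg k) = γ.seg (k + 1))
    (hall : ∀ s, Valid q s → ∃ γ ∈ G, ∃ k, γ.seg k = s) : Describes G σ q where
  mem_segments s := by
    constructor
    · rintro ⟨γ, hγ, k, rfl⟩
      exact hv γ hγ k
    · exact hall s
  consecutive s t := by
    constructor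
    · rintro ⟨γ, hγ, k, rfl, rfl⟩
      exact ⟨hv γ hγ k, hf γ hγ k⟩
    · rintro ⟨hs, rfl⟩
      obtain ⟨γ, hγ, k, rfl⟩ := hall s hs
      exact ⟨γ, hγ, k, rfl, (hf γ hγ k).symm⟩

/-- The two connected curves contain the four edges at the origin, hence meet the orbit of every
valid segment. They leave no room for another curve in the covering. -/
theorem describes_of_connects {H : InftyCurve} {u : GaussianInt} (hu : IsUnit u) {ω : ℤˣ}
    (hseg : ∀ k : ℕ, emb 1 u (-u * H.start 1) (H.seg k.succPNat) =
      (flow (toeplitz ω period) 1 ^ k) ⟨0, 1⟩) {𝒞 : Set CompleteCurve} (h𝒞 : Covers 𝒞)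
    {γ δ : CompleteCurve} (hγ : γ ∈ 𝒞) (hδ : δ ∈ 𝒞) {a a' : ℕ} (ha : Odd a) (ha' : Odd a')
    (h1 : γ.Connects (H.rotate a) (H.rotate 0)) (h2 : δ.Connects (H.rotate a') (H.rotate 2))
    (h3 : ((ω : ℤ) : GaussianInt) * I * -I ^ a = I ^ 0)
    (h4 : ((ω : ℤ) : GaussianInt) * I * -I ^ a' = I ^ 2)
    (h5 : ∀ Z, Z = I ∨ Z = -I → Z = I ^ a ∨ Z = I ^ a') :
    Describes 𝒞 (fun y => toeplitz ω period ((1 : ℤ) * u * y + -u * H.start 1))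
      (orient u (-u * H.start 1)) := by
  obtain ⟨f1, ⟨k1, e1⟩, m1, g1⟩ := h1.flow_emb hseg ha Even.zero h3
  obtain ⟨f2, ⟨k2, e2⟩, m2, g2⟩ := h2.flow_emb hseg ha' even_two h4
  set c := -u * H.start 1 with hc
  set σ : GaussianInt → ℤˣ := fun y => toeplitz ω period ((1 : ℤ) * u * y + c) with hσ
  have hinj := emb_injective odd_one hu c
  have hflow : ∀ η : CompleteCurve, (∀ k, flow (toeplitz ω period) 1 (emb 1 u c (η.seg k)) =
      emb 1 u c (η.seg (k + 1))) → ∀ k, flow σ 1 (η.seg k) = η.seg (k + 1) := by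
    intro η h k
    apply hinj
    rw [← h]
    exact emb_flow _ _ _ _ _
  have hf : ∀ η ∈ ({γ, δ} : Set CompleteCurve), ∀ k, flow σ 1 (η.seg k) = η.seg (k + 1) := by
    rintro η (rfl | rfl)
    exacts [hflow _ f1, hflow _ f2]
  have hstar : ∀ e ∈ starEdges, ∃ η ∈ ({γ, δ} : Set CompleteCurve), ∃ k,
      emb 1 u c (η.seg k) = e := by
    have h6 : ∀ Z, Z = I ∨ Z = -I → ∃ η ∈ ({γ, δ} : Set CompleteCurve), ∃ k,
        emb 1 u c (η.seg k) = ⟨Z, -Z⟩ := by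
      intro Z hZ
      rcases h5 Z hZ with rfl | rfl
      exacts [⟨γ, Or.inl rfl, m1, g1⟩, ⟨δ, Or.inr rfl, m2, g2⟩]
    rintro e (rfl | rfl | rfl | rfl)
    · exact ⟨γ, Or.inl rfl, k1, by simpa using e1⟩
    · exact ⟨δ, Or.inr rfl, k2, by simpa [pow_two, I_mul_I] using e2⟩
    · exact h6 I (Or.inl rfl)
    · simpa using h6 (-I) (Or.inr rfl)
  have hall : ∀ s, Valid (orient u c) s → ∃ η ∈ ({γ, δ} : Set CompleteCurve), ∃ k,
      η.seg k = s := by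
    intro s hs
    obtain ⟨e, he, j, hj⟩ := exists_sameCycle_starEdges ω ((valid_emb odd_one hu c s).2 hs)
    obtain ⟨η, hη, k, rfl⟩ := hstar e he
    refine ⟨η, hη, k + j, hinj ?_⟩
    rw [seg_add_of_flow (hf η hη), ← hj]
    exact emb_zpow _ _ _ _ _ _
  have hv : ∀ η ∈ ({γ, δ} : Set CompleteCurve), ∀ k, Valid (orient u c) (η.seg k) := by
    have h6 : ∀ η ∈ ({γ, δ} : Set CompleteCurve), ∃ k, Valid (orient u c) (η.seg k) := by
      rintro η (rfl | rfl)
      · refine ⟨k1, (valid_emb odd_one hu c _).1 ?_⟩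
        rw [e1]; simp [Valid, period, coordSum]
      · refine ⟨k2, (valid_emb odd_one hu c _).1 ?_⟩
        rw [e2]; simp [Valid, period, coordSum, pow_two, I_mul_I]
    intro η hη k
    obtain ⟨j, hj⟩ := h6 η hη
    have := seg_add_of_flow (hf η hη) j (k - j)
    rw [add_sub_cancel] at this
    rw [this]
    exact hj.zpow odd_one σ _
  rw [h𝒞.eq_of_subset (G := {γ, δ}) (by rintro η (rfl | rfl) <;> assumption) hall]
  exact describes_of_flow hv hf hall

/-! ### Local isomorphism -/

theorem toeplitz_congr (ω ω' : ℤˣ) (τ : ℕ → ℤ) {Z : GaussianInt} (hZ : Z ≠ 0) :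
    toeplitz ω τ Z = toeplitz ω' τ Z := by
  induction Z using gaussianInt_induction generalizing τ with
  | zero => simp at hZ
  | odd Z h => rw [toeplitz_odd _ _ h, toeplitz_odd _ _ h]
  | mul Z h ih => rw [toeplitz_mul, toeplitz_mul, ih _ h]

theorem one_add_I_pow_eight_mul (m : ℕ) : (1 + I) ^ (8 * m) = 16 ^ m := by
  rw [pow_mul, show (1 + I) ^ 8 = 16 by rfl]

theorem toeplitz_sixteen_pow_mul (ω : ℤˣ) (m : ℕ) (Z : GaussianInt) :
    toeplitz ω period (16 ^ m * Z) = toeplitz ω period Z := by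
  have h : ∀ (n : ℕ) (τ : ℕ → ℤ), toeplitz ω τ ((1 + I) ^ n * Z) = toeplitz ω (shift^[n] τ) Z := by
    intro n
    induction n with
    | zero => intro τ; simp
    | succ n ih =>
      intro τ
      rw [pow_succ', mul_assoc, toeplitz_mul, ih]
      rfl
  rw [← one_add_I_pow_eight_mul, h, iterate_shift shift_period]

theorem exists_uniform_toeplitz_add (ω : ℤˣ) {B : Set GaussianInt} (hB : B.Finite) :
    ∃ m : ℕ, 0 < m ∧ ∀ Z ∈ B, Z ≠ 0 → ∀ K,
      toeplitz ω period (Z + 16 ^ m * K) = toeplitz ω period Z := by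
  have h : ∀ Z ∈ B, ∀ᶠ m in Filter.atTop, Z ≠ 0 → ∀ K,
      toeplitz ω period (Z + 16 ^ m * K) = toeplitz ω period Z := by
    intro Z _
    by_cases hZ : Z = 0
    · simp [hZ]
    · obtain ⟨n, hn⟩ := exists_toeplitz_add ω period hZ
      filter_upwards [Filter.eventually_ge_atTop n] with m hm _ K
      rw [← one_add_I_pow_eight_mul]
      exact hn _ (by omega) K
  obtain ⟨m, hm, hm'⟩ := (((hB.eventually_all).2 h).and (Filter.eventually_gt_atTop 0)).exists
  exact ⟨m, hm', hm⟩

theorem exists_sixteen_pow (m : ℕ) : ∃ j : GaussianInt, (16 : GaussianInt) ^ m = 1 + 3 * j := by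
  obtain ⟨j, hj⟩ := sub_dvd_pow_sub_pow (16 : GaussianInt) 1 m
  refine ⟨5 * j, ?_⟩
  rw [one_pow] at hj
  linear_combination hj

theorem even_coordSum_sixteen_pow_mul {m : ℕ} (hm : 0 < m) (Z : GaussianInt) :
    Even (coordSum (16 ^ m * Z)) := by
  obtain ⟨m, rfl⟩ := Nat.exists_eq_succ_of_ne_zero hm.ne'
  have : (16 : GaussianInt) ^ (m + 1) * Z = (1 + I) * ((1 + I) ^ 7 * 16 ^ m * Z) := by
    rw [pow_succ', show (16 : GaussianInt) = (1 + I) * (1 + I) ^ 7 by rfl]; ring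
  rw [Nat.succ_eq_add_one, this]
  exact even_coordSum_mul _

theorem even_coordSum_unit_mul {u : GaussianInt} (hu : IsUnit u) (Z : GaussianInt) :
    Even (coordSum (u * Z)) ↔ Even (coordSum Z) := by
  rcases isUnit_cases hu with rfl | rfl | rfl | rfl <;>
    simp [coordSum, Int.even_add] <;> tauto

theorem even_translation {u c v X : GaussianInt} (hu : IsUnit u)
    (h : 3 * (u * v) = X + 3 * c - I ∨ 3 * (u * v) = X + I - 3 * c) (hX : Even (coordSum X)) :
    Even (coordSum v + orient u c + orient u I) := by
  have h3 : ∀ Z, Even (coordSum (3 * Z)) ↔ Even (coordSum Z) := by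
    intro Z
    rw [show (3 : GaussianInt) * Z = ((3 : ℤ) : GaussianInt) * Z by norm_num,
      coordSum_intCast_mul, Int.even_mul]
    simp [show ¬ Even (3 : ℤ) by decide]
  have h4 : Even (coordSum v) ↔ ¬ Even (coordSum c) := by
    have hs : ∀ Z W, coordSum (Z - W) = coordSum Z - coordSum W := fun Z W => by
      simp [coordSum]; ring
    have hI : ¬ Even (coordSum I) := by decide
    rw [← even_coordSum_unit_mul hu, ← h3]
    rcases h with h | h <;> rw [h] <;>
      simp only [hs, coordSum_add, Int.even_sub, Int.even_add, h3, hX, hI] <;> tauto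
  have h5 : coordSum v + orient u c + orient u I =
      coordSum v + coordSum c + 1 + 2 * u.im := by
    simp [orient, period, coordSum]; ring
  rw [h5]
  simp only [Int.even_add, h4, even_two_mul, Int.not_even_one]
  tauto

theorem exists_translation_to {u : GaussianInt} (hu : IsUnit u) (c : GaussianInt) (ω : ℤˣ)
    {B : Set GaussianInt} (hB : B.Finite) :
    ∃ v, Even (coordSum v + orient u c + orient u I) ∧ ∀ y ∈ B,
      toeplitz 1 period ((3 : ℤ) * u * (y + v) + I) =
        toeplitz ω period ((1 : ℤ) * u * y + c) := by
  obtain ⟨m, hm, h⟩ := exists_uniform_toeplitz_add 1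
    (hB.image fun y => 3 * ((1 : ℤ) * u * y + c))
  obtain ⟨j, hj⟩ := exists_sixteen_pow m
  obtain ⟨u', hu'⟩ := hu.exists_right_inv
  -- The vertex 0 will be sent to 16 ^ m (i + 3K), whose sign is that of i + 3K. Both signs occur on
  -- the coset: +1 at 3 + 4i and -1 at i.
  obtain ⟨K, hK⟩ : ∃ K, toeplitz 1 period (I + 3 * K) = ω := by
    rcases Int.units_eq_one_or ω with rfl | rfl
    · exact ⟨1 + I, by rw [toeplitz_odd _ _ (by decide)]; rfl⟩
    · exact ⟨0, by rw [toeplitz_odd _ _ (by decide)]; rfl⟩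
  -- With 16 ^ m = 1 + 3j, this v makes 3u(y + v) + i equal to 3(uy + c) plus a multiple of 16 ^ m.
  have hv : 3 * (u * (u' * (c + j * I + 16 ^ m * K))) = 16 ^ m * (I + 3 * K) + 3 * c - I := by
    linear_combination 3 * (c + j * I + 16 ^ m * K) * hu' - I * hj
  refine ⟨u' * (c + j * I + 16 ^ m * K),
    even_translation hu (Or.inl hv) (even_coordSum_sixteen_pow_mul hm _), fun y hy => ?_⟩
  have h1 : (3 : ℤ) * u * (y + u' * (c + j * I + 16 ^ m * K)) + I =
      3 * ((1 : ℤ) * u * y + c) + 16 ^ m * (I + 3 * K) := by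
    push_cast
    linear_combination hv
  rw [h1]
  by_cases h0 : ((1 : ℤ) : GaussianInt) * u * y + c = 0
  · rw [h0, mul_zero, zero_add, toeplitz_sixteen_pow_mul, hK, toeplitz_zero]
  · rw [h _ (Set.mem_image_of_mem _ hy) (mul_ne_zero (by decide) h0), toeplitz_three_mul,
      toeplitz_congr 1 ω _ h0]

theorem exists_translation_from {u : GaussianInt} (hu : IsUnit u) (c : GaussianInt) (ω : ℤˣ)
    {B : Set GaussianInt} (hB : B.Finite) :
    ∃ v, Even (coordSum v + orient u I + orient u c) ∧ ∀ y ∈ B,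
      toeplitz ω period ((1 : ℤ) * u * (y + v) + c) =
        toeplitz 1 period ((3 : ℤ) * u * y + I) := by
  obtain ⟨m, hm, h⟩ := exists_uniform_toeplitz_add ω (hB.image fun y => (3 : ℤ) * u * y + I)
  obtain ⟨j, hj⟩ := exists_sixteen_pow m
  obtain ⟨u', hu'⟩ := hu.exists_right_inv
  -- Here 3(u(y + v) + c) = (3uy + i) - 16 ^ m i, and 3uy + i is never 0, so the translation
  -- preserves its sign.
  have hv : 3 * (u * (u' * (-j * I - c))) = 16 ^ m * (-I) + I - 3 * c := by
    linear_combination 3 * (-j * I - c) * hu' + I * hj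
  refine ⟨u' * (-j * I - c), ?_, fun y hy => ?_⟩
  · rw [add_right_comm]
    exact even_translation hu (Or.inr hv) (even_coordSum_sixteen_pow_mul hm _)
  have h0 : ((3 : ℤ) : GaussianInt) * u * y + I ≠ 0 := by
    intro h0
    have := congrArg Zsqrtd.im h0
    rw [mul_assoc, Zsqrtd.im_add, Zsqrtd.im_smul, I_im, Zsqrtd.im_zero] at this
    omega
  rw [← toeplitz_three_mul, toeplitz_congr 1 ω _ h0, ← h _ (Set.mem_image_of_mem _ hy) h0 (-I)]
  congr 1
  push_cast
  linear_combination hv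

end Paperfolding

theorem mainTheorem7 (S : ℕ+ → ℤˣ) (hS : Paperfolding.IsInftyFolding S)
    (hval : ∀ n : ℕ, S (2 ^ (4 * n)) = 1 ∧ S (2 ^ (4 * n + 1)) = 1 ∧
      S (2 ^ (4 * n + 2)) = -1 ∧ S (2 ^ (4 * n + 3)) = -1)
    (H : Paperfolding.InftyCurve) (hH : H.turn = S)
    (𝒞 : Set Paperfolding.CompleteCurve) (h𝒞 : Paperfolding.IsGeneratedBy 𝒞 H) :
    ∃ 𝒟 : Set Paperfolding.CompleteCurve, Paperfolding.IsFoldingCovering 𝒟 ∧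
      𝒟.ncard = 4 ∧ Paperfolding.LocallyIsomorphic 𝒞 𝒟 := by
  open Paperfolding in
  obtain ⟨u, hu⟩ := (H.isUnit_dir 1).exists_left_inv
  have huu : IsUnit u := IsUnit.of_mul_eq_one _ hu
  -- Over one period the parities are 0, 0, 0, 1, and the sums of consecutive ones 0, 0, 1, 1 give
  -- the signs +1, +1, -1, -1.
  have hg : ∀ n : ℕ, S (Nat.toPNat' (2 ^ n)) = Int.negOnePow (period n + period (n + 1)) := by
    intro n
    have hp : Nat.toPNat' (2 ^ n) = 2 ^ n := by
      apply PNat.coe_injective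
      rw [Nat.toPNat'_coe, if_pos (by positivity)]; simp
    rw [hp]
    obtain ⟨h0, h1, h2, h3⟩ := hval (n / 4)
    have h4 : n = 4 * (n / 4) + n % 4 := (Nat.div_add_mod n 4).symm
    have h5 : n % 4 < 4 := Nat.mod_lt _ (by norm_num)
    unfold period
    rw [Nat.add_mod]
    generalize n / 4 = q at *
    generalize n % 4 = r at *
    subst h4
    interval_cases r
    · simpa using h0
    · simpa using h1
    · simpa using h2
    · simpa using h3
  have hfold : Folds fun k => S (Nat.toPNat' (k + 1)) := hS
  have hseg : ∀ (ω : ℤˣ) (k : ℕ), emb 1 u (-u * H.start 1) (H.seg k.succPNat) =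
      (flow (toeplitz ω period) 1 ^ k) ⟨0, 1⟩ := by
    intro ω
    refine InftyCurve.emb_seg hH hu ω fun k => ?_
    have := turn_eq ω (g := fun m => S (Nat.toPNat' m)) hfold hg k.succ_pos 0 (p := ⟨0, 1⟩)
      (by simp [Valid, period, coordSum]) rfl
    rw [Nat.succ_eq_add_one, pow_zero, one_mul] at this
    exact this
  -- The two ways of connecting the four copies correspond to the two possible turns ω at the
  -- origin.
  obtain ⟨ω, hC⟩ : ∃ ω, Describes 𝒞
      (fun y => toeplitz ω period ((1 : ℤ) * u * y + -u * H.start 1))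
      (orient u (-u * H.start 1)) := by
    obtain ⟨hcov, γ, hγ, δ, hδ, ⟨h1, h2⟩ | ⟨h1, h2⟩⟩ := h𝒞
    · exact ⟨1, describes_of_connects huu (hseg 1) hcov.covers hγ hδ (by decide) (by decide) h1 h2
        (by decide) (by decide) (by
          rintro Z (rfl | rfl)
          exacts [Or.inl (by decide), Or.inr (by decide)])⟩
    · exact ⟨-1, describes_of_connects huu (hseg (-1)) hcov.covers hγ hδ (by decide) (by decide)
        h1 h2 (by decide) (by decide) (by
          rintro Z (rfl | rfl)
          exacts [Or.inr (by decide), Or.inl (by decide)])⟩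
  obtain ⟨𝒟, h1, h2, hD⟩ := exists_covering_four huu
  exact ⟨𝒟, h1, h2, hC.patternsAppearIn hD fun B hB => exists_translation_to huu _ ω hB,
    hD.patternsAppearIn hC fun B hB => exists_translation_from huu _ ω hB⟩
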